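/- Let $d$ be a dimension, $\mathcal{L}^d$ Lebesgue measure on $\mathbb{R}^d$ and $e_1,\dots,e_d$ the canonical basis. Let $\mathcal{M}$ be the set of Lebesgue measurable subsets of $\mathbb{R}^d$ modulo Lebesgue-negligible sets, with the topology of local convergence in measure ($A_n\to A$ iff $\mathcal{L}^d((A_n\Delta A)\cap U)\to 0$ for every bounded open $U$) and its Borel $\sigma$-algebra. A random measurable set (RAMS) is a measurable map $X$ from a probability space to $\mathcal{M}$; it is stationary if $t+X$ has the same law as $X$ for every $t\in\mathbb{R}^d$. Its specific covariogram is $\gamma^s_X(y)=\mathbf{E}\,\mathcal{L}^d(X\cap(y+X)\cap(0,1)^d)$. For $A\in\mathcal{M}$, $U\subset\mathbb{R}^d$ open and $u\in\mathbb{R}^d$, put $$\mathrm{Per}(A;U)=\sup\Big\{\int_U \mathbf{1}_A\operatorname{div}\varphi\,dx:\ \varphi\in C^1_c(U,\mathbb{R}^d),\ \|\varphi(x)\|_2\le 1\ \forall x\Big\},$$ $$V_u(A;U)=\sup\Big\{\int_U \mathbf{1}_A\langle\nabla\varphi,u\rangle\,dx:\ \varphi\in C^1_c(U,\mathbb{R}),\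 |\varphi(x)|\le 1\ \forall x\Big\},$$ $$\mathrm{Per}_{\mathbf{B}}(A;U)=\sum_{j=1}^d V_{e_j}(A;U).$$ For a stationary RAMS $X$, the specific perimeter is $\mathrm{Per}^s(X)=\mathbf{E}\,\mathrm{Per}(X;(0,1)^d)$ and the specific anisotropic perimeter is $\mathrm{Per}^s_{\mathbf{B}}(X)=\mathbf{E}\,\mathrm{Per}_{\mathbf{B}}(X;(0,1)^d)$; both lie in $[0,\infty]$. Let $\mathcal{W}$ be the set of bounded open $W\subset\mathbb{R}^d$ with $\mathcal{L}^d(\partial W)=0$, and $\delta_{y;W}(A)=\mathcal{L}^d(A\cap(y+A)\cap W)$. A function $S_2:\mathbb{R}^d\to\mathbb{R}$ is ($\mathcal{M}$-specific covariogram) admissible if for all $q\ge1$, $a_1,\dots,a_q\in\mathbb{R}$, $y_1,\dots,y_q\in\mathbb{R}^d$, $W_1,\dots,W_q\in\mathcal{W}$ and $c\in\mathbb{R}$, $$\Big[\forall A\in\mathcal{M},\ c+\sum_{i=1}^q a_i\,\delta_{y_i;W_i}(A)\ge0\Big]\ \Longrightarrow\ c+\sum_{i=1}^q a_i\,S_2(y_i)\,\mathcal{L}^d(W_i)\ge0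 .$$ Put $\mathrm{Lip}_j(S_2,0)=\sup_{t\neq0}|S_2(te_j)-S_2(0)|/|t|\in[0,\infty]$. **Theorem.** Let $S_2:\mathbb{R}^d\to\mathbb{R}$. 1. For every real $r\ge0$, there is a stationary RAMS $X$ with $\gamma^s_X(y)=S_2(y)$ for all $y\in\mathbb{R}^d$ and $\mathrm{Per}^s_{\mathbf{B}}(X)\le r$ if and only if $S_2$ is admissible and $\sum_{j=1}^d\mathrm{Lip}_j(S_2,0)\le r/2$. 2. There is a stationary RAMS $X$ with $\gamma^s_X(y)=S_2(y)$ for all $y\in\mathbb{R}^d$ and $\mathrm{Per}^s(X)<\infty$ if and only if $S_2$ is admissible and Lipschitz at $0$ along the $d$ canonical directions, i.e. $\mathrm{Lip}_j(S_2,0)<\infty$ for every $j\in\{1,\dots,d\}$. -/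

import Mathlib

open MeasureTheory Filter Topology
open scoped symmDiff ENNReal Pointwise

universe u

noncomputable section

namespace RandomSets

/-- The Euclidean space `ℝ^d`, with its Euclidean norm and its Lebesgue measure `volume`. -/
abbrev E (d : ℕ) : Type := EuclideanSpace ℝ (Fin d)

/-- The canonical basis vector `e_j` of `ℝ^d`. -/
def basisVec {d : ℕ} (j : Fin d) : E d := EuclideanSpace.single j 1

/-- The open unit cube `(0,1)^d`. -/
def unitCube (d : ℕ) : Set (E d) := {x | ∀ j, x j ∈ Set.Ioo (0 : ℝ) 1}

/-! ### The space of Lebesgue classes of measurable sets -/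

/-- Lebesgue measurable subsets of `ℝ^d` (sets that are measurable for the completion of the Borel
sigma-algebra with respect to Lebesgue measure). -/
abbrev LSet (d : ℕ) : Type := {A : Set (E d) // NullMeasurableSet A volume}

/-- Equality up to a Lebesgue-negligible set. -/
instance aeSetoid (d : ℕ) : Setoid (LSet d) where
  r A B := A.1 =ᵐ[volume] B.1
  iseqv := ⟨fun _ => EventuallyEq.rfl, fun h => h.symm, fun h₁ h₂ => h₁.trans h₂⟩

/-- The space `𝓜` of Lebesgue measurable subsets of `ℝ^d`, modulo Lebesgue-negligible sets. -/
def MSet (d : ℕ) : Type := Quotient (aeSetoid d)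

/-- The class of a Lebesgue measurable set. -/
def MSet.mk {d : ℕ} (A : LSet d) : MSet d := Quotient.mk (aeSetoid d) A

/-- `𝓛^d((A ∆ B) ∩ U)`. -/
def locDist {d : ℕ} (U : Set (E d)) (A B : MSet d) : ℝ≥0∞ :=
  Quotient.liftOn₂ A B (fun A B => volume ((A.1 ∆ B.1) ∩ U)) (by
    intro A B A' B' hA hB
    have hA' : A.1 =ᵐ[volume] A'.1 := hA
    have hB' : B.1 =ᵐ[volume] B'.1 := hB
    exact measure_congr ((((hA'.diff hB').union (hB'.diff hA'))).inter EventuallyEq.rfl))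

/-- The topology of local convergence in measure on `𝓜`, generated by the balls of the
pseudometrics `(A, B) ↦ 𝓛^d((A ∆ B) ∩ U)`, for `U` a bounded open set. -/
instance MSet.instTopologicalSpace (d : ℕ) : TopologicalSpace (MSet d) :=
  TopologicalSpace.generateFrom
    {s | ∃ (U : Set (E d)) (B : MSet d) (ε : ℝ≥0∞), IsOpen U ∧ Bornology.IsBounded U ∧ 0 < ε ∧
      s = {A | locDist U A B < ε}}

/-- `𝓜` indeed carries the topology of local convergence in measure: `A_n → A` if and only if
`𝓛^d((A_n ∆ A) ∩ U) → 0` for all bounded open sets `U`. -/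
theorem MSet.tendsto_iff {d : ℕ} {ι : Type*} {l : Filter ι} {A : ι → MSet d} {B : MSet d} :
    Tendsto A l (𝓝 B) ↔ ∀ U : Set (E d), IsOpen U → Bornology.IsBounded U →
      Tendsto (fun n => locDist U (A n) B) l (𝓝 0) := by
  have hself : ∀ (U : Set (E d)) (C : MSet d), locDist U C C = 0 := by
    intro U C
    induction C using Quotient.inductionOn with
    | h C => simp [locDist]
  have htri : ∀ (U : Set (E d)) (C D F : MSet d),
      locDist U C F ≤ locDist U C D + locDist U D F := by
    intro U C D F
    induction C using Quotient.inductionOn with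
    | h C =>
    induction D using Quotient.inductionOn with
    | h D =>
    induction F using Quotient.inductionOn with
    | h F =>
      change volume ((C.1 ∆ F.1) ∩ U) ≤ volume ((C.1 ∆ D.1) ∩ U) + volume ((D.1 ∆ F.1) ∩ U)
      refine (measure_mono ?_).trans (measure_union_le _ _)
      rw [← Set.union_inter_distrib_right]
      exact Set.inter_subset_inter_left _ (symmDiff_triangle C.1 D.1 F.1)
  constructor
  · intro h U hU hUb
    rw [ENNReal.tendsto_nhds_zero]
    intro ε hε
    have hopen : IsOpen {C : MSet d | locDist U C B < ε} :=
      TopologicalSpace.isOpen_generateFrom_of_mem ⟨U, B, ε, hU, hUb, hε, rfl⟩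
    have hmem : B ∈ {C : MSet d | locDist U C B < ε} := by simpa [hself] using hε
    filter_upwards [h (hopen.mem_nhds hmem)] with n hn using le_of_lt hn
  · intro h
    refine TopologicalSpace.tendsto_nhds_generateFrom_iff.2 ?_
    rintro s ⟨U, C, ε, hU, hUb, -, rfl⟩ hB
    have h1 : Tendsto (fun n => locDist U (A n) B + locDist U B C) l
        (𝓝 (0 + locDist U B C)) := (h U hU hUb).add tendsto_const_nhds
    rw [zero_add] at h1
    filter_upwards [h1.eventually (gt_mem_nhds hB)] with n hn
    exact (htri U (A n) B C).trans_lt hn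

/-- The Borel sigma-algebra of `𝓜`. -/
instance MSet.instMeasurableSpace (d : ℕ) : MeasurableSpace (MSet d) := borel (MSet d)

instance MSet.instBorelSpace (d : ℕ) : BorelSpace (MSet d) := ⟨rfl⟩

/-- The translate `t + A` of a class of measurable sets. -/
def MSet.translate {d : ℕ} (t : E d) (A : MSet d) : MSet d :=
  Quotient.map (fun A : LSet d => (⟨t +ᵥ A.1, A.2.vadd t⟩ : LSet d))
    (fun A B (h : A.1 =ᵐ[volume] B.1) => (vadd_set_ae_eq t).2 h) A

/-! ### Covariograms and admissible functions -/

/-- The set `𝓦` of observation windows. -/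
def Window (d : ℕ) : Type :=
  {W : Set (E d) // IsOpen W ∧ Bornology.IsBounded W ∧ volume (frontier W) = 0}

/-- The local covariogram `δ_{y;W}(A) = 𝓛^d(A ∩ (y + A) ∩ W)`. -/
def localCov {d : ℕ} (y : E d) (W : Set (E d)) (A : MSet d) : ℝ :=
  Quotient.liftOn A (fun A => volume.real (A.1 ∩ (y +ᵥ A.1) ∩ W)) (by
    intro A A' hA
    have hA' : A.1 =ᵐ[volume] A'.1 := hA
    exact congrArg ENNReal.toReal (measure_congr
      ((hA'.inter ((vadd_set_ae_eq y).2 hA')).inter EventuallyEq.rfl)))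

/-- `γ : ℝ^d × 𝓦 → ℝ` is `𝓜`-local covariogram admissible. -/
def IsLocalAdmissible {d : ℕ} (γ : E d → Window d → ℝ) : Prop :=
  ∀ (q : ℕ), 1 ≤ q → ∀ (a : Fin q → ℝ) (y : Fin q → E d) (W : Fin q → Window d) (c : ℝ),
    (∀ A : MSet d, 0 ≤ c + ∑ i, a i * localCov (y i) (W i).1 A) →
      0 ≤ c + ∑ i, a i * γ (y i) (W i)

/-- `S₂ : ℝ^d → ℝ` is `𝓜`-specific covariogram admissible. -/
def IsAdmissible {d : ℕ} (S₂ : E d → ℝ) : Prop :=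
  IsLocalAdmissible fun y (W : Window d) => S₂ y * volume.real W.1

/-- `Lip_j(F, y) = sup_{t ≠ 0} |F(y + t e_j) - F(y)| / |t|`, with values in `[0, ∞]`. -/
def lipAt {d : ℕ} (j : Fin d) (F : E d → ℝ) (y : E d) : ℝ≥0∞ :=
  ⨆ (t : ℝ) (_ : t ≠ 0), ENNReal.ofReal (|F (y + t • basisVec j) - F y| / |t|)

/-! ### Perimeters

The suprema below are taken in `[0, ∞]`; since `φ = 0` is a test function, replacing negative
integrals by `0` does not change them. Test functions in `C¹_c(U)` are extended by zero to
`ℝ^d`. -/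

/-- The divergence of a vector field. -/
def divergence {d : ℕ} (φ : E d → E d) (x : E d) : ℝ :=
  ∑ j, (fderiv ℝ φ x (basisVec j)) j

/-- The variational perimeter `Per(A; U)`. -/
def perimeter {d : ℕ} (U : Set (E d)) (A : MSet d) : ℝ≥0∞ :=
  Quotient.liftOn A
    (fun A => ⨆ (φ : E d → E d) (_ : ContDiff ℝ 1 φ) (_ : HasCompactSupport φ)
      (_ : tsupport φ ⊆ U) (_ : ∀ x, ‖φ x‖ ≤ 1),
      ENNReal.ofReal (∫ x in U, A.1.indicator (fun z => divergence φ z) x)) (by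
    intro A A' hA
    have hA' : A.1 =ᵐ[volume] A'.1 := hA
    have key : ∀ φ : E d → E d,
        ∫ x in U, A.1.indicator (fun z => divergence φ z) x =
          ∫ x in U, A'.1.indicator (fun z => divergence φ z) x := fun φ =>
      integral_congr_ae (ae_restrict_of_ae (indicator_ae_eq_of_ae_eq_set hA'))
    simp only [key])

/-- The directional variation `V_u(A; U)`; here `fderiv ℝ φ x u` is `⟨∇φ(x), u⟩`. -/
def dirVariation {d : ℕ} (u : E d) (U : Set (E d)) (A : MSet d) : ℝ≥0∞ :=
  Quotient.liftOn A
    (fun A => ⨆ (φ : E d → ℝ) (_ : ContDiff ℝ 1 φ) (_ : HasCompactSupport φ)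
      (_ : tsupport φ ⊆ U) (_ : ∀ x, |φ x| ≤ 1),
      ENNReal.ofReal (∫ x in U, A.1.indicator (fun z => fderiv ℝ φ z u) x)) (by
    intro A A' hA
    have hA' : A.1 =ᵐ[volume] A'.1 := hA
    have key : ∀ φ : E d → ℝ,
        ∫ x in U, A.1.indicator (fun z => fderiv ℝ φ z u) x =
          ∫ x in U, A'.1.indicator (fun z => fderiv ℝ φ z u) x := fun φ =>
      integral_congr_ae (ae_restrict_of_ae (indicator_ae_eq_of_ae_eq_set hA'))
    simp only [key])

/-- The anisotropic perimeter `Per_B(A; U) = ∑_j V_{e_j}(A; U)`. -/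
def anisoPerimeter {d : ℕ} (U : Set (E d)) (A : MSet d) : ℝ≥0∞ :=
  ∑ j : Fin d, dirVariation (basisVec j) U A

/-! ### Stationary random measurable sets -/

section

variable {d : ℕ} {Ω : Type u} [MeasurableSpace Ω]

/-- `X` is a stationary random measurable set: a measurable map into `𝓜` with its Borel
sigma-algebra, whose law under `P` is invariant under all translations. -/
structure IsStationaryRAMS (P : Measure Ω) (X : Ω → MSet d) : Prop where
  measurable : Measurable X
  stationary : ∀ t : E d, P.map (fun ω => (X ω).translate t) = P.map X

/-- The specific covariogram `γ^s_X(y) = 𝔼 𝓛^d(X ∩ (y + X) ∩ (0,1)^d)`. -/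
def specificCov (P : Measure Ω) (X : Ω → MSet d) (y : E d) : ℝ :=
  ∫ ω, localCov y (unitCube d) (X ω) ∂P

/-- The specific perimeter `Per^s(X) = 𝔼 Per(X; (0,1)^d)`. -/
def specificPer (P : Measure Ω) (X : Ω → MSet d) : ℝ≥0∞ :=
  ∫⁻ ω, perimeter (unitCube d) (X ω) ∂P

/-- The specific anisotropic perimeter `Per_B^s(X) = 𝔼 Per_B(X; (0,1)^d)`. -/
def specificAnisoPer (P : Measure Ω) (X : Ω → MSet d) : ℝ≥0∞ :=
  ∫⁻ ω, anisoPerimeter (unitCube d) (X ω) ∂P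

end

end RandomSets

end

/-!
The argument has two halves.

**Covariogram and perimeter of a stationary set.** Let `X` be a stationary random measurable set
with specific covariogram `γ`. By stationarity and the uniqueness of Haar measure,
`𝔼 𝓛^d(X ∩ (y + X) ∩ B) = γ(y) 𝓛^d(B)` for every Borel set `B`
(`IsStationaryRAMS.lintegral_covMeasure`). Integrating an inequality between local covariograms
shows that `γ` is admissible, and inclusion–exclusion gives
`𝔼 𝓛^d((X ∆ (t + X)) ∩ W) = 2 (γ(0) - γ(t)) 𝓛^d(W)`. On the other hand `V_u(A; U)` is compared
with the increments of `A` in the direction `u`: it is at most the lower limit of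
`𝓛^d((A ∆ (tu + A)) ∩ U) / t` as `t ↓ 0` (`dirVariation_le_liminf`), and on a slightly smaller
window the increment is at most `|t| V_u(A; U)` (`shiftDist_smul_le`). Taking expectations, with
Fatou's lemma for the first bound, and with the subadditivity of `t ↦ γ(0) - γ(t)` for the second
in order to pass from short translations to all of them, yields
`𝔼 V_{e_j}(X; (0,1)^d) = 2 Lip_j(γ, 0)`. The anisotropic specific perimeter of `X` is therefore
`2 ∑_j Lip_j(γ, 0)`, and the isotropic one is finite at the same time.

**Realizability.** Let `S` be admissible with finite constants `Lip_j(S, 0)`. It remains to find a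
stationary random measurable set with covariogram `S`. The two-point functions of random fields
indexed by *all* points of `ℝ^d`, with values in `{0, 1}`, are easier to realize, since
`{0,1}^(ℝ^d)` is compact: evaluating a nonnegative polynomial `c + ∑ a_i ω(x_i) ω(y_i)` at the
fields `x ↦ 1_A(x + z)` and averaging over `z ∈ (0,1)^d` gives a combination of local covariograms
of `A`, so that admissibility makes the prescription `ω(x) ω(y) ↦ S(x - y)` positive
(`IsAdmissible.covGraph_nonneg`). A Hahn–Banach argument with ergodic averages
(`exists_invariant_positive_extension`) and the Riesz–Markov–Kakutani theorem give a
translation-invariant law on `{0,1}^(ℝ^d)` with these two-point functions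
(`IsAdmissible.exists_field`). Under this law `ω` is Lipschitz in probability,
`ℙ(ω(x) ≠ ω(y)) ≤ 2 ∑_j Lip_j(S, 0) |x_j - y_j|`, so by the Borel–Cantelli lemma its dyadic
discretizations converge almost surely at each point (`ae_mem_fieldSet_iff`). Their upper limit is
a jointly measurable version of the field, whose sections are the required random sets: the
covariogram is computed by Fubini's theorem, and stationarity is inherited from the invariance of
the law.
-/

noncomputable section

namespace RandomSets

/-! ### The space of Lebesgue classes -/

section Classes

variable {d : ℕ}

/-- The class in `𝓜` of a Borel set. -/
def MSet.ofSet (B : Set (E d)) (hB : MeasurableSet B) : MSet d :=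
  MSet.mk ⟨B, hB.nullMeasurableSet⟩

theorem MSet.exists_ofSet (A : MSet d) : ∃ B, ∃ hB : MeasurableSet B, MSet.ofSet B hB = A := by
  induction A using Quotient.inductionOn with
  | h A =>
    obtain ⟨B, -, hB, hAB⟩ := A.2.exists_measurable_superset_ae_eq
    exact ⟨B, hB, Quotient.sound hAB⟩

theorem MSet.ofSet_eq_iff {A B : Set (E d)} {hA : MeasurableSet A} {hB : MeasurableSet B} :
    MSet.ofSet A hA = MSet.ofSet B hB ↔ A =ᵐ[volume] B :=
  Quotient.eq (r := aeSetoid d)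

/-- A Borel set in the class `A`. -/
def MSet.rep (A : MSet d) : Set (E d) := A.exists_ofSet.choose

theorem MSet.measurableSet_rep (A : MSet d) : MeasurableSet A.rep :=
  A.exists_ofSet.choose_spec.choose

@[simp] theorem MSet.ofSet_rep (A : MSet d) : MSet.ofSet A.rep A.measurableSet_rep = A :=
  A.exists_ofSet.choose_spec.choose_spec

theorem locDist_ofSet (U : Set (E d)) {A B : Set (E d)} (hA : MeasurableSet A)
    (hB : MeasurableSet B) :
    locDist U (MSet.ofSet A hA) (MSet.ofSet B hB) = volume ((A ∆ B) ∩ U) := rfl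

theorem locDist_eq (U : Set (E d)) (A B : MSet d) :
    locDist U A B = volume ((A.rep ∆ B.rep) ∩ U) := by
  conv_lhs => rw [← A.ofSet_rep, ← B.ofSet_rep]
  rfl

theorem locDist_comm (U : Set (E d)) (A B : MSet d) : locDist U A B = locDist U B A := by
  rw [locDist_eq, locDist_eq, symmDiff_comm]

theorem locDist_self (U : Set (E d)) (A : MSet d) : locDist U A A = 0 := by
  simp [locDist_eq]

theorem locDist_triangle (U : Set (E d)) (A B C : MSet d) :
    locDist U A C ≤ locDist U A B + locDist U B C := by
  simp only [locDist_eq]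
  refine (measure_mono ?_).trans (measure_union_le _ _)
  rw [← Set.union_inter_distrib_right]
  exact Set.inter_subset_inter_left _ (symmDiff_triangle _ _ _)

theorem locDist_mono {U V : Set (E d)} (h : U ⊆ V) (A B : MSet d) :
    locDist U A B ≤ locDist V A B := by
  simp only [locDist_eq]
  exact measure_mono (Set.inter_subset_inter_right _ h)

theorem locDist_ne_top {U : Set (E d)} (hU : Bornology.IsBounded U) (A B : MSet d) :
    locDist U A B ≠ ⊤ := by
  rw [locDist_eq]
  exact ((measure_mono Set.inter_subset_right).trans_lt hU.measure_lt_top).ne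

theorem MSet.translate_ofSet (t : E d) {A : Set (E d)} (hA : MeasurableSet A) :
    (MSet.ofSet A hA).translate t = MSet.ofSet (t +ᵥ A) (hA.const_vadd t) := rfl

theorem MSet.translate_zero (A : MSet d) : A.translate 0 = A := by
  obtain ⟨B, hB, rfl⟩ := A.exists_ofSet
  simp [MSet.translate_ofSet]

theorem MSet.translate_translate (s t : E d) (A : MSet d) :
    (A.translate t).translate s = A.translate (s + t) := by
  obtain ⟨B, hB, rfl⟩ := A.exists_ofSet
  simp [MSet.translate_ofSet, vadd_vadd]

/-- Translations are isometries up to a translation of the window. -/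
theorem locDist_translate (t : E d) (U : Set (E d)) (A B : MSet d) :
    locDist (t +ᵥ U) (A.translate t) (B.translate t) = locDist U A B := by
  obtain ⟨A, hA, rfl⟩ := A.exists_ofSet
  obtain ⟨B, hB, rfl⟩ := B.exists_ofSet
  rw [MSet.translate_ofSet, MSet.translate_ofSet, locDist_ofSet, locDist_ofSet,
    ← Set.vadd_set_symmDiff, ← Set.vadd_set_inter, measure_vadd]

/-- Map from `𝓜` to a countable product of spaces `L¹`, which induces the topology of local
convergence in measure. -/
def MSet.toLp (A : MSet d) (m : ℕ) : Lp ℝ 1 (volume.restrict (Metric.ball (0 : E d) m)) :=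
  indicatorConstLp 1 A.measurableSet_rep
    ((measure_mono (Set.subset_univ _)).trans_lt (by
      simpa using (Metric.isBounded_ball (x := (0 : E d)) (r := m)).measure_lt_top)).ne 1

theorem MSet.edist_toLp (A B : MSet d) (m : ℕ) :
    edist (A.toLp m) (B.toLp m) = locDist (Metric.ball 0 m) A B := by
  have hm := A.measurableSet_rep.symmDiff B.measurableSet_rep
  unfold MSet.toLp
  rw [edist_indicatorConstLp_eq_enorm, Lp.enorm_def,
    eLpNorm_congr_ae indicatorConstLp_coeFn,
    eLpNorm_indicator_const hm one_ne_zero ENNReal.one_ne_top]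
  simp [Measure.restrict_apply hm, locDist_eq]

theorem MSet.isInducing_toLp : IsInducing (MSet.toLp (d := d)) := by
  rw [isInducing_iff_nhds]
  intro B
  apply le_antisymm
  · rw [← tendsto_iff_comap]
    rw [tendsto_pi_nhds]
    intro m
    rw [tendsto_iff_edist_tendsto_0]
    simp only [MSet.edist_toLp]
    exact MSet.tendsto_iff.1 tendsto_id _ Metric.isOpen_ball Metric.isBounded_ball
  · have : Tendsto id (comap MSet.toLp (𝓝 B.toLp)) (𝓝 B) := by
      rw [MSet.tendsto_iff]
      intro U _ hU
      obtain ⟨m, hm⟩ : ∃ m : ℕ, U ⊆ Metric.ball 0 m := by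
        obtain ⟨r, hr⟩ := hU.subset_ball 0
        obtain ⟨m, hm⟩ := exists_nat_ge r
        exact ⟨m, hr.trans (Metric.ball_subset_ball hm)⟩
      have h := (tendsto_pi_nhds.1 (tendsto_comap (f := MSet.toLp) (x := 𝓝 B.toLp))) m
      rw [tendsto_iff_edist_tendsto_0] at h
      simp only [MSet.edist_toLp] at h
      exact tendsto_of_tendsto_of_tendsto_of_le_of_le tendsto_const_nhds h
        (fun _ => zero_le) (fun A => locDist_mono hm _ _)
    exact this

instance MSet.instSecondCountableTopology : SecondCountableTopology (MSet d) :=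
  haveI : Fact ((1 : ℝ≥0∞) ≠ ⊤) := ⟨ENNReal.one_ne_top⟩
  have (m : ℕ) : SecondCountableTopology
      (Lp ℝ 1 ((volume : Measure (E d)).restrict (Metric.ball (0 : E d) m))) := inferInstance
  have : SecondCountableTopology
      (∀ m : ℕ, Lp ℝ 1 ((volume : Measure (E d)).restrict (Metric.ball (0 : E d) m))) :=
    TopologicalSpace.instSecondCountableTopologyForallOfCountable
  MSet.isInducing_toLp.secondCountableTopology

/-- By second countability, a map into `𝓜` is Borel as soon as its local distances to fixed classes
are measurable. -/
theorem MSet.measurable_of_locDist {Ω : Type*} [MeasurableSpace Ω] {X : Ω → MSet d}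
    (hX : ∀ U : Set (E d), IsOpen U → ∀ B : MSet d,
      Measurable fun ω => locDist U (X ω) B) : Measurable X := by
  rw [show MSet.instMeasurableSpace d = borel (MSet d) from rfl,
    borel_eq_generateFrom_of_subbasis rfl]
  refine measurable_generateFrom ?_
  rintro _ ⟨U, B, ε, hU, -, -, rfl⟩
  exact (hX U hU B) measurableSet_Iio

theorem MSet.continuous_translate (t : E d) : Continuous (MSet.translate t) := by
  rw [continuous_iff_continuousAt]
  intro B
  refine MSet.tendsto_iff.2 fun U hU hUb => ?_
  have h := MSet.tendsto_iff.1 (tendsto_id (α := MSet d) (x := 𝓝 B)) (-t +ᵥ U) (hU.vadd _)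
    (hUb.vadd _)
  refine h.congr fun A => ?_
  rw [← locDist_translate t]
  simp

/-- A functional which varies at most as a local distance does is continuous. -/
theorem MSet.continuous_of_le_locDist {F : MSet d → ℝ≥0∞} {U : Set (E d)} (hU : IsOpen U)
    (hUb : Bornology.IsBounded U) {c : ℝ≥0∞} (hc : c ≠ ⊤) (hF' : ∀ A, F A ≠ ⊤)
    (hF : ∀ A B, F A ≤ F B + c * locDist U A B) : Continuous F := by
  rw [continuous_iff_continuousAt]
  intro B
  have h : Tendsto (fun A => c * locDist U A B) (𝓝 B) (𝓝 0) := by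
    simpa using ENNReal.Tendsto.const_mul
      (MSet.tendsto_iff.1 (tendsto_id (α := MSet d) (x := 𝓝 B)) U hU hUb) (Or.inr hc)
  have h1 : Tendsto (fun A => F B - c * locDist U A B) (𝓝 B) (𝓝 (F B)) := by
    simpa using ENNReal.Tendsto.sub tendsto_const_nhds h (Or.inl (hF' B))
  have h2 : Tendsto (fun A => F B + c * locDist U A B) (𝓝 B) (𝓝 (F B)) := by
    simpa using tendsto_const_nhds.add h
  refine tendsto_of_tendsto_of_tendsto_of_le_of_le h1 h2 (fun A => ?_) (fun A => hF A B)
  rw [tsub_le_iff_right, locDist_comm]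
  exact hF B A

/-- The local covariogram `𝓛^d(A ∩ (y + A) ∩ W)`, with values in `[0, ∞]`. -/
def covMeasure (y : E d) (W : Set (E d)) (A : MSet d) : ℝ≥0∞ :=
  volume (A.rep ∩ (y +ᵥ A.rep) ∩ W)

theorem covMeasure_ofSet (y : E d) (W : Set (E d)) {A : Set (E d)} (hA : MeasurableSet A) :
    covMeasure y W (MSet.ofSet A hA) = volume (A ∩ (y +ᵥ A) ∩ W) := by
  have h : (MSet.ofSet A hA).rep =ᵐ[volume] A :=
    MSet.ofSet_eq_iff.1 (MSet.ofSet_rep (MSet.ofSet A hA))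
  exact measure_congr ((h.inter ((vadd_set_ae_eq y).2 h)).inter EventuallyEq.rfl)

theorem localCov_eq (y : E d) (W : Set (E d)) (A : MSet d) :
    localCov y W A = (covMeasure y W A).toReal := by
  conv_lhs => rw [← A.ofSet_rep]
  rfl

theorem covMeasure_le (y : E d) (W : Set (E d)) (A : MSet d) : covMeasure y W A ≤ volume W :=
  measure_mono Set.inter_subset_right

theorem covMeasure_translate (t y : E d) (W : Set (E d)) (A : MSet d) :
    covMeasure y (t +ᵥ W) (A.translate t) = covMeasure y W A := by
  obtain ⟨A, hA, rfl⟩ := A.exists_ofSet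
  rw [MSet.translate_ofSet, covMeasure_ofSet, covMeasure_ofSet, vadd_comm,
    ← Set.vadd_set_inter, ← Set.vadd_set_inter, measure_vadd]

theorem continuous_covMeasure (y : E d) {W : Set (E d)} (hW : Bornology.IsBounded W) :
    Continuous (covMeasure y W) := by
  obtain ⟨r, hr⟩ := (hW.union (hW.vadd (-y))).subset_ball 0
  refine MSet.continuous_of_le_locDist (U := Metric.ball 0 r) (c := 2) Metric.isOpen_ball
    Metric.isBounded_ball (by simp)
    (fun A => ((covMeasure_le y W A).trans_lt hW.measure_lt_top).ne) fun A B => ?_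
  obtain ⟨A, hA, rfl⟩ := A.exists_ofSet
  obtain ⟨B, hB, rfl⟩ := B.exists_ofSet
  have h2 : volume ((y +ᵥ A) ∆ (y +ᵥ B) ∩ (y +ᵥ Metric.ball (0 : E d) r)) =
      volume ((A ∆ B) ∩ Metric.ball (0 : E d) r) := by
    rw [← Set.vadd_set_symmDiff, ← Set.vadd_set_inter, measure_vadd]
  rw [covMeasure_ofSet, covMeasure_ofSet, locDist_ofSet, two_mul]
  nth_rewrite 2 [← h2]
  refine (measure_mono ?_).trans ((measure_union_le _ _).trans
    (add_le_add le_rfl (measure_union_le _ _)))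
  rintro x ⟨⟨hxA, hxA'⟩, hxW⟩
  have hx1 : x ∈ Metric.ball (0 : E d) r := hr (Or.inl hxW)
  have hx2 : x ∈ y +ᵥ Metric.ball (0 : E d) r := by
    rw [Set.mem_vadd_set_iff_neg_vadd_mem]
    exact hr (Or.inr (Set.vadd_mem_vadd_set hxW))
  by_cases hxB : x ∈ B
  · by_cases hxB' : x ∈ y +ᵥ B
    · exact Or.inl ⟨⟨hxB, hxB'⟩, hxW⟩
    · exact Or.inr (Or.inr ⟨Or.inl ⟨hxA', hxB'⟩, hx2⟩)
  · exact Or.inr (Or.inl ⟨Or.inl ⟨hxA, hxB⟩, hx1⟩)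

/-- Continuity holds for bounded windows; the other ones are exhausted by balls. -/
theorem measurable_covMeasure (y : E d) (W : Set (E d)) :
    Measurable (covMeasure y W) := by
  have h : covMeasure y W = fun A => ⨆ m : ℕ, covMeasure y (W ∩ Metric.ball 0 m) A := by
    funext A
    have hW' : A.rep ∩ (y +ᵥ A.rep) ∩ W =
        ⋃ m : ℕ, A.rep ∩ (y +ᵥ A.rep) ∩ (W ∩ Metric.ball 0 m) := by
      rw [← Set.inter_iUnion, ← Set.inter_iUnion, Metric.iUnion_ball_nat, Set.inter_univ]
    unfold covMeasure
    rw [hW', Monotone.measure_iUnion]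
    intro m n hmn
    exact Set.inter_subset_inter_right _
      (Set.inter_subset_inter_right _ (Metric.ball_subset_ball (by exact_mod_cast hmn)))
  rw [h]
  exact Measurable.iSup fun m =>
    (continuous_covMeasure y (Metric.isBounded_ball.subset Set.inter_subset_right)).measurable

/-- The increment `𝓛^d((A ∆ (t + A)) ∩ W)`. -/
def shiftDist (t : E d) (W : Set (E d)) (A : MSet d) : ℝ≥0∞ := locDist W A (A.translate t)

theorem continuous_shiftDist (t : E d) {W : Set (E d)}
    (hWb : Bornology.IsBounded W) : Continuous (shiftDist t W) := by
  obtain ⟨r, hr⟩ := (hWb.union (hWb.vadd (-t))).subset_ball 0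
  refine MSet.continuous_of_le_locDist (U := Metric.ball 0 r) (c := 2) Metric.isOpen_ball
    Metric.isBounded_ball (by simp) (fun A => locDist_ne_top hWb _ _) fun A B => ?_
  have h1 : locDist W A B ≤ locDist (Metric.ball 0 r) A B :=
    locDist_mono (fun x hx => hr (Or.inl hx)) _ _
  have h2 : locDist W (B.translate t) (A.translate t) ≤ locDist (Metric.ball 0 r) A B := by
    have h3 : locDist W (B.translate t) (A.translate t) = locDist (-t +ᵥ W) B A := by
      rw [← locDist_translate t (-t +ᵥ W) B A]; simp
    rw [h3, locDist_comm]
    exact locDist_mono (fun x hx => hr (Or.inr hx)) _ _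
  calc shiftDist t W A ≤ locDist W A B + locDist W B (A.translate t) := locDist_triangle _ _ _ _
    _ ≤ locDist W A B + (shiftDist t W B + locDist W (B.translate t) (A.translate t)) := by
        gcongr; exact locDist_triangle _ _ _ _
    _ ≤ locDist (Metric.ball 0 r) A B + (shiftDist t W B + locDist (Metric.ball 0 r) A B) := by
        gcongr
    _ = shiftDist t W B + 2 * locDist (Metric.ball 0 r) A B := by ring

/-- Inclusion–exclusion for the increments. -/
theorem shiftDist_add_two_mul_covMeasure (t : E d) {W : Set (E d)} (hW : MeasurableSet W)
    (A : MSet d) :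
    shiftDist t W A + 2 * covMeasure t W A =
      covMeasure 0 W A + covMeasure 0 W (A.translate t) := by
  obtain ⟨A, hA, rfl⟩ := A.exists_ofSet
  have hB : MeasurableSet (t +ᵥ A) := hA.const_vadd t
  rw [shiftDist, MSet.translate_ofSet, locDist_ofSet, covMeasure_ofSet, covMeasure_ofSet,
    covMeasure_ofSet, zero_vadd, zero_vadd, Set.inter_self, Set.inter_self]
  set B := t +ᵥ A
  have h1 : volume ((A ∆ B) ∩ W) = volume ((A ∩ W) \ B) + volume ((B ∩ W) \ A) := by
    rw [← measure_union]
    · congr 1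
      ext x
      simp only [Set.mem_inter_iff, Set.mem_symmDiff, Set.mem_union, Set.mem_sdiff]
      tauto
    · rw [Set.disjoint_left]
      rintro x ⟨⟨h1, -⟩, -⟩ ⟨-, h2⟩
      exact h2 h1
    · exact (hB.inter hW).diff hA
  have h2 : A ∩ B ∩ W = (A ∩ W) ∩ B := by ext x; simp only [Set.mem_inter_iff]; tauto
  have h3 : A ∩ B ∩ W = (B ∩ W) ∩ A := by ext x; simp only [Set.mem_inter_iff]; tauto
  rw [h1, two_mul, ← measure_inter_add_sdiff (A ∩ W) hB, ← measure_inter_add_sdiff (B ∩ W) hA,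
    ← h2, ← h3]
  ring

end Classes

/-! ### Directional variation and increments -/

section Variation

variable {d : ℕ}

theorem fderiv_apply_eq_zero {φ : E d → ℝ} {U : Set (E d)} (hU : tsupport φ ⊆ U) (u : E d)
    {x : E d} (hx : x ∉ U) : fderiv ℝ φ x u = 0 := by
  have : x ∉ tsupport (fderiv ℝ φ) := fun h => hx (hU (tsupport_fderiv_subset ℝ h))
  rw [image_eq_zero_of_notMem_tsupport this]
  rfl

theorem dirVariation_ofSet (u : E d) (U : Set (E d)) {A : Set (E d)} (hA : MeasurableSet A) :
    dirVariation u U (MSet.ofSet A hA) =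
      ⨆ (φ : E d → ℝ) (_ : ContDiff ℝ 1 φ) (_ : HasCompactSupport φ)
        (_ : tsupport φ ⊆ U) (_ : ∀ x, |φ x| ≤ 1),
        ENNReal.ofReal (∫ x in A, fderiv ℝ φ x u) := by
  refine iSup_congr fun φ => iSup_congr fun _ => iSup_congr fun _ => iSup_congr fun hU =>
    iSup_congr fun _ => ?_
  change ENNReal.ofReal (∫ x in U, A.indicator (fun z => fderiv ℝ φ z u) x) = _
  rw [setIntegral_eq_integral_of_forall_compl_eq_zero, integral_indicator hA]
  intro x hx
  rw [Set.indicator_apply_eq_zero]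
  exact fun _ => fderiv_apply_eq_zero hU u hx

theorem ofReal_setIntegral_le_dirVariation (u : E d) {U : Set (E d)} {A : Set (E d)}
    (hA : MeasurableSet A) {φ : E d → ℝ} (h1 : ContDiff ℝ 1 φ) (h2 : HasCompactSupport φ)
    (h3 : tsupport φ ⊆ U) (h4 : ∀ x, |φ x| ≤ 1) :
    ENNReal.ofReal (∫ x in A, fderiv ℝ φ x u) ≤ dirVariation u U (MSet.ofSet A hA) := by
  rw [dirVariation_ofSet]
  exact le_iSup_of_le φ (le_iSup_of_le h1 (le_iSup_of_le h2 (le_iSup_of_le h3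
    (le_iSup_of_le h4 le_rfl))))

theorem dirVariation_ofSet_le (u : E d) {U : Set (E d)} {A : Set (E d)}
    (hA : MeasurableSet A) {c : ℝ≥0∞}
    (h : ∀ φ : E d → ℝ, ContDiff ℝ 1 φ → HasCompactSupport φ → tsupport φ ⊆ U →
      (∀ x, |φ x| ≤ 1) → ENNReal.ofReal (∫ x in A, fderiv ℝ φ x u) ≤ c) :
    dirVariation u U (MSet.ofSet A hA) ≤ c := by
  rw [dirVariation_ofSet]
  exact iSup_le fun φ => iSup_le fun h1 => iSup_le fun h2 => iSup_le fun h3 => iSup_le fun h4 =>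
    h φ h1 h2 h3 h4

/-- The integral over a fixed set of a test function translated along a line is differentiable. -/
theorem hasDerivAt_setIntegral_comp_add_smul {φ : E d → ℝ} (h1 : ContDiff ℝ 1 φ)
    (h2 : HasCompactSupport φ) (A : Set (E d)) (u : E d) (s : ℝ) :
    HasDerivAt (fun s : ℝ => ∫ x in A, φ (x + s • u)) (∫ x in A, fderiv ℝ φ (x + s • u) u) s := by
  have hcont' : Continuous (fderiv ℝ φ) := h1.continuous_fderiv one_ne_zero
  obtain ⟨C, hC⟩ := (h2.fderiv ℝ).exists_bound_of_continuous hcont'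
  obtain ⟨r, hr⟩ := h2.isCompact.isBounded.subset_ball 0
  set R : ℝ := r + (|s| + 1) * ‖u‖
  have hC0 : 0 ≤ C := (norm_nonneg _).trans (hC 0)
  have hcont : ∀ t : ℝ, Continuous fun x : E d => φ (x + t • u) := fun t =>
    h1.continuous.comp (continuous_id.add continuous_const)
  refine (hasDerivAt_integral_of_dominated_loc_of_deriv_le (μ := volume.restrict A)
    (F := fun (s : ℝ) x => φ (x + s • u)) (F' := fun (s : ℝ) x => fderiv ℝ φ (x + s • u) u)
    (bound := (Metric.ball (0 : E d) R).indicator fun _ => C * ‖u‖) (s := Metric.ball s 1)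
    (Metric.ball_mem_nhds s one_pos) (Eventually.of_forall fun t =>
      (hcont t).aestronglyMeasurable) ?_ ?_ (Eventually.of_forall ?_) ?_
      (Eventually.of_forall ?_)).2
  · exact ((hcont s).integrable_of_hasCompactSupport
      (h2.comp_homeomorph (Homeomorph.addRight (s • u)))).integrableOn
  · exact Continuous.aestronglyMeasurable (by fun_prop)
  · intro x t ht
    by_cases hx : x + t • u ∈ tsupport φ
    · have hxR : x ∈ Metric.ball (0 : E d) R := by
        have h3 : ‖x + t • u‖ < r := by simpa using hr hx
        have h4 : |t| < |s| + 1 := by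
          have h5 : |t - s| < 1 := ht
          have h6 := abs_sub_abs_le_abs_sub t s
          linarith
        rw [mem_ball_zero_iff]
        calc ‖x‖ = ‖(x + t • u) - t • u‖ := by simp
          _ ≤ ‖x + t • u‖ + ‖t • u‖ := norm_sub_le _ _
          _ = ‖x + t • u‖ + |t| * ‖u‖ := by rw [norm_smul, Real.norm_eq_abs]
          _ < R := by
            have := mul_le_mul_of_nonneg_right h4.le (norm_nonneg u)
            simp only [R]; linarith
      rw [Set.indicator_of_mem hxR]
      exact (ContinuousLinearMap.le_opNorm _ _).trans
        (mul_le_mul_of_nonneg_right (hC _) (norm_nonneg _))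
    · rw [fderiv_apply_eq_zero subset_rfl u hx, norm_zero]
      exact Set.indicator_nonneg (fun _ _ => mul_nonneg hC0 (norm_nonneg _)) _
  · rw [integrable_indicator_iff measurableSet_ball]
    refine (integrableOn_const ?_).mono_measure Measure.restrict_le_self |>.mono_set subset_rfl
    exact measure_ball_lt_top.ne
  · intro x t _
    have h3 : HasFDerivAt φ (fderiv ℝ φ (x + t • u)) (x + t • u) :=
      (h1.differentiable one_ne_zero _).hasFDerivAt
    have h4 : HasDerivAt (fun t : ℝ => x + t • u) u t := by
      simpa using ((hasDerivAt_id t).smul_const u).const_add x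
    exact h3.comp_hasDerivAt t h4

theorem setIntegral_vadd_set (t : E d) {A : Set (E d)} (hA : MeasurableSet A) (ψ : E d → ℝ) :
    ∫ x in t +ᵥ A, ψ x = ∫ x in A, ψ (x + t) := by
  rw [← integral_indicator hA, ← integral_indicator (hA.const_vadd t),
    ← integral_add_right_eq_self _ t]
  refine integral_congr_ae (Eventually.of_forall fun x => ?_)
  have : x + t ∈ t +ᵥ A ↔ x ∈ A := by
    rw [Set.mem_vadd_set_iff_neg_vadd_mem, vadd_eq_add, neg_add_cancel_comm_assoc]
  by_cases hx : x ∈ A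
  · simp [hx, this.2 hx]
  · simp [hx, mt this.1 hx]

theorem setIntegral_sub_setIntegral {A B : Set (E d)} (hA : MeasurableSet A)
    (hB : MeasurableSet B) {W : Set (E d)} {ψ : E d → ℝ} (hψ : Integrable ψ)
    (hW : ∀ x ∉ W, ψ x = 0) :
    (∫ x in B, ψ x) - ∫ x in A, ψ x = (∫ x in (B \ A) ∩ W, ψ x) - ∫ x in (A \ B) ∩ W, ψ x := by
  have h : ∀ C : Set (E d), MeasurableSet C → ∫ x in C ∩ W, ψ x = ∫ x in C, ψ x := by
    intro C hC
    rw [← Measure.restrict_restrict hC, ← integral_indicator hC, ← integral_indicator hC]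
    refine setIntegral_eq_integral_of_forall_compl_eq_zero fun x hx => ?_
    simp [hW x hx]
  rw [h _ (hB.diff hA), h _ (hA.diff hB), ← integral_inter_add_sdiff hA hψ.integrableOn (s := B),
    ← integral_inter_add_sdiff hB hψ.integrableOn (s := A), Set.inter_comm B A]
  ring

theorem measureReal_symmDiff_inter {A B W : Set (E d)} (hA : MeasurableSet A)
    (hB : MeasurableSet B) (hW : MeasurableSet W) (hWf : volume W ≠ ⊤) :
    volume.real ((A ∆ B) ∩ W) = volume.real ((B \ A) ∩ W) + volume.real ((A \ B) ∩ W) := by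
  have hfin : ∀ C : Set (E d), volume (C ∩ W) ≠ ⊤ := fun C =>
    ((measure_mono Set.inter_subset_right).trans_lt hWf.lt_top).ne
  rw [← measureReal_union _ ((hA.diff hB).inter hW) (hfin _) (hfin _),
    ← Set.union_inter_distrib_right, Set.union_comm]
  · rfl
  · rw [Set.disjoint_left]
    rintro x ⟨⟨h1, -⟩, -⟩ ⟨⟨-, h2⟩, -⟩
    exact h2 h1

theorem setIntegral_sub_setIntegral_le {A B W : Set (E d)} (hA : MeasurableSet A)
    (hB : MeasurableSet B) (hW : MeasurableSet W) (hWf : volume W ≠ ⊤) {ψ : E d → ℝ}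
    (hψ : Integrable ψ) (hψW : ∀ x ∉ W, ψ x = 0) (hψ1 : ∀ x, |ψ x| ≤ 1) :
    (∫ x in B, ψ x) - (∫ x in A, ψ x) ≤ volume.real ((A ∆ B) ∩ W) := by
  have hfin : ∀ C : Set (E d), volume (C ∩ W) < ⊤ := fun C =>
    (measure_mono Set.inter_subset_right).trans_lt hWf.lt_top
  have h : ∀ C : Set (E d), |∫ x in C ∩ W, ψ x| ≤ volume.real (C ∩ W) := by
    intro C
    simpa using norm_setIntegral_le_of_norm_le_const (hfin C) (f := ψ) (C := 1) (fun x _ => hψ1 x)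
  rw [setIntegral_sub_setIntegral hA hB hψ hψW, measureReal_symmDiff_inter hA hB hW hWf]
  have h1 := abs_le.1 (h (B \ A))
  have h2 := abs_le.1 (h (A \ B))
  linarith

/-- A `C¹` function with values in `[-1, 1]`, supported in an open set, that is close to the sign
function prescribed by two disjoint compact sets. -/
theorem exists_test_function {K₁ K₂ W : Set (E d)} (hK₁ : IsCompact K₁) (hK₂ : IsCompact K₂)
    (hd : Disjoint K₁ K₂) (hW : IsOpen W) (h₁ : K₁ ⊆ W) (h₂ : K₂ ⊆ W) :
    ∃ ψ : E d → ℝ, ContDiff ℝ 1 ψ ∧ HasCompactSupport ψ ∧ tsupport ψ ⊆ W ∧ (∀ x, |ψ x| ≤ 1) ∧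
      (∀ x ∈ K₁, ψ x = 1) ∧ ∀ x ∈ K₂, ψ x = -1 := by
  obtain ⟨L, hL, hKL, hLW⟩ := exists_compact_between (hK₁.union hK₂) hW (Set.union_subset h₁ h₂)
  have hLc : IsClosed (interior L)ᶜ := isOpen_interior.isClosed_compl
  have key : ∀ K K' : Set (E d), IsCompact K → IsCompact K' → Disjoint K K' → K ⊆ interior L →
      ∃ f : E d → ℝ, ContDiff ℝ 1 f ∧ (∀ x ∉ interior L, f x = 0) ∧ (∀ x ∈ K', f x = 0) ∧
        (∀ x ∈ K, f x = 1) ∧ ∀ x, f x ∈ Set.Icc (0 : ℝ) 1 := by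
    intro K K' hK hK' hKK' hKL
    obtain ⟨f, hf0, hf1, hf⟩ := exists_contMDiffMap_zero_one_of_isClosed (n := 1)
      (modelWithCornersSelf ℝ (E d)) (hLc.union hK'.isClosed) hK.isClosed (by
        rw [Set.disjoint_union_left]
        exact ⟨Set.disjoint_left.2 fun x hx hxK => hx (hKL hxK), hKK'.symm⟩)
    exact ⟨f, f.contMDiff.contDiff, fun x hx => hf0 (Or.inl hx), fun x hx => hf0 (Or.inr hx),
      fun x hx => hf1 hx, hf⟩
  obtain ⟨f, hf, hfL, hf2, hf1, hfI⟩ := key K₁ K₂ hK₁ hK₂ hd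
    (Set.subset_union_left.trans hKL)
  obtain ⟨g, hg, hgL, hg1, hg2, hgI⟩ := key K₂ K₁ hK₂ hK₁ hd.symm
    (Set.subset_union_right.trans hKL)
  have hsupp : tsupport (f - g) ⊆ L := by
    refine closure_minimal (fun x hx => ?_) hL.isClosed
    by_contra hxL
    have hxL' : x ∉ interior L := fun h => hxL (interior_subset h)
    exact hx (by simp [hfL x hxL', hgL x hxL'])
  refine ⟨f - g, hf.sub hg, hL.of_isClosed_subset (isClosed_tsupport _) hsupp,
    hsupp.trans hLW, fun x => ?_, fun x hx => ?_, fun x hx => ?_⟩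
  · have h1 := hfI x
    have h2 := hgI x
    simp only [Pi.sub_apply]
    rw [abs_le]
    constructor <;> linarith [h1.1, h1.2, h2.1, h2.2]
  · simp [hf1 x hx, hg1 x hx]
  · simp [hf2 x hx, hg2 x hx]

/-- The integral over `P` of a function bounded by `1`, and equal to `1` on a large part `K` of `P`,
is almost the measure of `P`. -/
theorem sub_le_setIntegral_of_eq_one {P K : Set (E d)}
    (hPf : volume P ≠ ⊤) (hK : MeasurableSet K) (hKP : K ⊆ P) {ψ : E d → ℝ} (hψ : Integrable ψ)
    (hψ1 : ∀ x, |ψ x| ≤ 1) (hψK : ∀ x ∈ K, ψ x = 1) {η : ℝ}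
    (hη : volume.real P ≤ volume.real K + η) :
    volume.real P - 2 * η ≤ ∫ x in P, ψ x := by
  have hPK : volume (P \ K) < ⊤ := (measure_mono Set.sdiff_subset).trans_lt hPf.lt_top
  have h1 : ∫ x in K, ψ x = volume.real K := by
    rw [setIntegral_congr_fun hK hψK]; simp
  have h2 : |∫ x in P \ K, ψ x| ≤ volume.real (P \ K) := by
    simpa using norm_setIntegral_le_of_norm_le_const hPK (f := ψ) (C := 1) (fun x _ => hψ1 x)
  have h3 := integral_inter_add_sdiff hK hψ.integrableOn (s := P)
  rw [Set.inter_eq_self_of_subset_right hKP, h1] at h3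
  have h4 := measureReal_sdiff_add_inter (s := P) hK (by exact hPf)
  rw [Set.inter_eq_self_of_subset_right hKP] at h4
  have h5 := (abs_le.1 h2).1
  linarith

/-- Duality: the measure of a symmetric difference inside an open set is approached by integrating
test functions. -/
theorem exists_test_function_symmDiff {A B W : Set (E d)} (hA : MeasurableSet A)
    (hB : MeasurableSet B) (hW : IsOpen W) (hWf : volume W ≠ ⊤) {η : ℝ} (hη : 0 < η) :
    ∃ ψ : E d → ℝ, ContDiff ℝ 1 ψ ∧ HasCompactSupport ψ ∧ tsupport ψ ⊆ W ∧ (∀ x, |ψ x| ≤ 1) ∧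
      volume.real ((A ∆ B) ∩ W) - η ≤ (∫ x in B, ψ x) - ∫ x in A, ψ x := by
  have hfin : ∀ C : Set (E d), volume (C ∩ W) ≠ ⊤ := fun C =>
    ((measure_mono Set.inter_subset_right).trans_lt hWf.lt_top).ne
  have hP := (hB.diff hA).inter hW.measurableSet
  have hN := (hA.diff hB).inter hW.measurableSet
  have key : ∀ P : Set (E d), MeasurableSet P → volume P ≠ ⊤ → ∃ K ⊆ P, IsCompact K ∧
      volume.real P ≤ volume.real K + η / 4 := by
    intro P hP hPf
    obtain ⟨K, hKP, hK, h⟩ := hP.exists_isCompact_lt_add hPf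
      (ε := ENNReal.ofReal (η / 4)) (by simpa using hη)
    refine ⟨K, hKP, hK, ?_⟩
    have h' := ENNReal.toReal_mono (by simp [hK.measure_ne_top]) h.le
    rwa [ENNReal.toReal_add hK.measure_ne_top ENNReal.ofReal_ne_top,
      ENNReal.toReal_ofReal (by positivity)] at h'
  obtain ⟨K₁, hK₁P, hK₁, hv₁⟩ := key _ hP (hfin _)
  obtain ⟨K₂, hK₂N, hK₂, hv₂⟩ := key _ hN (hfin _)
  obtain ⟨ψ, h1, h2, h3, h4, h5, h6⟩ := exists_test_function hK₁ hK₂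
    (Set.disjoint_left.2 fun x hx hx' => (hK₂N hx').1.2 (hK₁P hx).1.1) hW
    (hK₁P.trans Set.inter_subset_right) (hK₂N.trans Set.inter_subset_right)
  have hint : Integrable ψ := h1.continuous.integrable_of_hasCompactSupport h2
  refine ⟨ψ, h1, h2, h3, h4, ?_⟩
  rw [setIntegral_sub_setIntegral hA hB hint
    (fun x hx => image_eq_zero_of_notMem_tsupport fun h => hx (h3 h)),
    measureReal_symmDiff_inter hA hB hW.measurableSet hWf]
  have e1 := sub_le_setIntegral_of_eq_one (hfin _) hK₁.measurableSet hK₁P hint h4 h5 hv₁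
  have e2 := sub_le_setIntegral_of_eq_one (hfin _) hK₂.measurableSet hK₂N hint.neg
    (fun x => by simpa using h4 x) (fun x hx => by simp [h6 x hx]) hv₂
  simp only [Pi.neg_apply] at e2
  rw [integral_neg] at e2
  linarith

/-- The increments of a set in the direction `u` are bounded by its variation in this direction. -/
theorem shiftDist_smul_le (u : E d) (t : ℝ) {U W : Set (E d)} (hW : IsOpen W)
    (hWb : Bornology.IsBounded W) (hWU : ∀ x ∈ W, ∀ s ∈ Set.uIcc 0 t, x - s • u ∈ U)
    (A : MSet d) :
    shiftDist (t • u) W A ≤ ENNReal.ofReal |t| * dirVariation u U A := by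
  obtain ⟨A, hA, rfl⟩ := A.exists_ofSet
  rcases eq_or_ne t 0 with rfl | ht
  · simp [shiftDist, MSet.translate_zero, locDist_self]
  rcases eq_or_ne (dirVariation u U (MSet.ofSet A hA)) ⊤ with htop | htop
  · rw [htop, ENNReal.mul_top (by simpa using ht)]
    exact le_top
  set V := (dirVariation u U (MSet.ofSet A hA)).toReal with hV
  have hWf : volume W ≠ ⊤ := hWb.measure_lt_top.ne
  have hB : MeasurableSet (t • u +ᵥ A) := hA.const_vadd _
  have hVd : ∀ φ : E d → ℝ, ContDiff ℝ 1 φ → HasCompactSupport φ → tsupport φ ⊆ U →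
      (∀ x, |φ x| ≤ 1) → ∫ x in A, fderiv ℝ φ x u ≤ V := fun φ h1 h2 h3 h4 => by
    have h := ofReal_setIntegral_le_dirVariation u hA h1 h2 h3 h4
    rw [hV]
    exact (ENNReal.ofReal_le_iff_le_toReal htop).1 h
  have main : volume.real ((A ∆ (t • u +ᵥ A)) ∩ W) ≤ |t| * V := by
    refine le_of_forall_pos_sub_le fun η hη => ?_
    obtain ⟨ψ, h1, h2, h3, h4, h5⟩ := exists_test_function_symmDiff hA hB hW hWf hη
    refine h5.trans ?_
    rw [setIntegral_vadd_set _ hA]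
    -- the translates of `ψ` by `-s • u`, for `s` between `0` and `t`, are test functions in `U`, so
    -- the derivative of `g` is at most `V` on this interval
    set g : ℝ → ℝ := fun s => ∫ x in A, ψ (x + s • u) with hg
    have hbound : ∀ s ∈ Set.uIcc 0 t, ‖∫ x in A, fderiv ℝ ψ (x + s • u) u‖ ≤ V := by
      intro s hs
      have htr : tsupport (fun x => ψ (x + s • u)) ⊆ U := by
        intro x hx
        have hx' : x + s • u ∈ tsupport ψ :=
          (tsupport_comp_subset_preimage ψ (f := fun x => x + s • u) (by fun_prop)) hx
        simpa using hWU _ (h3 hx') s hs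
      have hc : ContDiff ℝ 1 fun x => ψ (x + s • u) := by fun_prop
      have hcs : HasCompactSupport fun x => ψ (x + s • u) :=
        h2.comp_homeomorph (Homeomorph.addRight (s • u))
      have e1 := hVd _ hc hcs htr (fun x => h4 _)
      have e2 := hVd (fun x => -ψ (x + s • u)) hc.neg hcs.neg
        (by
          have : (fun x => -ψ (x + s • u)) = -(fun x => ψ (x + s • u)) := rfl
          rwa [this, tsupport_neg]) (fun x => by simpa using h4 _)
      simp only [fderiv_comp_add_right, fderiv_fun_neg, neg_apply,
        integral_neg] at e1 e2
      rw [Real.norm_eq_abs, abs_le]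
      constructor <;> linarith
    have h := (convex_uIcc (0 : ℝ) t).norm_image_sub_le_of_norm_hasDerivWithin_le (f := g)
      (fun s _ => (hasDerivAt_setIntegral_comp_add_smul h1 h2 A u s).hasDerivWithinAt) hbound
      Set.left_mem_uIcc Set.right_mem_uIcc
    simp only [hg, zero_smul, add_zero, sub_zero, Real.norm_eq_abs] at h
    rw [mul_comm]
    exact (le_abs_self _).trans h
  rw [shiftDist, MSet.translate_ofSet, locDist_ofSet, ← ENNReal.ofReal_toReal htop,
    ← ENNReal.ofReal_mul (abs_nonneg t)]
  exact (ENNReal.le_ofReal_iff_toReal_le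
    ((measure_mono Set.inter_subset_right).trans_lt hWf.lt_top).ne
    (mul_nonneg (abs_nonneg _) ENNReal.toReal_nonneg)).2 main

/-- The variation in the direction `u` is at most the lower limit of the difference quotients. -/
theorem dirVariation_le_liminf (u : E d) {U : Set (E d)} (hU : IsOpen U)
    (hUb : Bornology.IsBounded U) {t : ℕ → ℝ} (ht : ∀ n, 0 < t n) (ht0 : Tendsto t atTop (𝓝 0))
    (A : MSet d) :
    dirVariation u U A ≤
      liminf (fun n => ENNReal.ofReal (t n)⁻¹ * shiftDist (t n • u) U A) atTop := by
  obtain ⟨A, hA, rfl⟩ := A.exists_ofSet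
  have hUf : volume U ≠ ⊤ := hUb.measure_lt_top.ne
  refine dirVariation_ofSet_le u hA fun φ h1 h2 h3 h4 => ?_
  have hint : Integrable φ := h1.continuous.integrable_of_hasCompactSupport h2
  have hder := hasDerivAt_setIntegral_comp_add_smul h1 h2 A u 0
  simp only [zero_smul, add_zero] at hder
  have ht' : Tendsto t atTop (𝓝[≠] 0) :=
    tendsto_nhdsWithin_iff.2 ⟨ht0, Eventually.of_forall fun n => (ht n).ne'⟩
  have hlim := (hder.tendsto_slope_zero).comp ht'
  rw [← (ENNReal.tendsto_ofReal hlim).liminf_eq]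
  refine liminf_le_liminf (Eventually.of_forall fun n => ?_)
  have hB : MeasurableSet (t n • u +ᵥ A) := hA.const_vadd _
  have h := setIntegral_sub_setIntegral_le hA hB hU.measurableSet hUf hint
    (fun x hx => image_eq_zero_of_notMem_tsupport fun h => hx (h3 h)) h4
  rw [setIntegral_vadd_set _ hA] at h
  simp only [Function.comp_apply, zero_add, zero_smul, add_zero, smul_eq_mul]
  rw [ENNReal.ofReal_mul (inv_nonneg.2 (ht n).le), shiftDist, MSet.translate_ofSet, locDist_ofSet]
  gcongr
  exact (ENNReal.ofReal_le_iff_le_toReal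
    ((measure_mono Set.inter_subset_right).trans_lt hUf.lt_top).ne).2 h

/-! ### Comparison of the two perimeters -/

/-- As for the directional variation, the support condition makes the integration domain `U`
immaterial. -/
theorem perimeter_ofSet (U : Set (E d)) {A : Set (E d)} (hA : MeasurableSet A) :
    perimeter U (MSet.ofSet A hA) =
      ⨆ (φ : E d → E d) (_ : ContDiff ℝ 1 φ) (_ : HasCompactSupport φ)
        (_ : tsupport φ ⊆ U) (_ : ∀ x, ‖φ x‖ ≤ 1),
        ENNReal.ofReal (∫ x in A, divergence φ x) := by
  refine iSup_congr fun φ => iSup_congr fun _ => iSup_congr fun _ => iSup_congr fun hU =>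
    iSup_congr fun _ => ?_
  change ENNReal.ofReal (∫ x in U, A.indicator (fun z => divergence φ z) x) = _
  rw [setIntegral_eq_integral_of_forall_compl_eq_zero, integral_indicator hA]
  intro x hx
  rw [Set.indicator_apply_eq_zero]
  intro _
  have : x ∉ tsupport (fderiv ℝ φ) := fun h => hx (hU (tsupport_fderiv_subset ℝ h))
  simp [divergence, image_eq_zero_of_notMem_tsupport this]

/-- A scalar test function `φ` gives the test field `φ e_j`. -/
theorem dirVariation_basisVec_le_perimeter (j : Fin d) (U : Set (E d)) (A : MSet d) :
    dirVariation (basisVec j) U A ≤ perimeter U A := by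
  obtain ⟨A, hA, rfl⟩ := A.exists_ofSet
  refine dirVariation_ofSet_le _ hA fun φ h1 h2 h3 h4 => ?_
  have hnorm : ‖(basisVec j : E d)‖ = 1 := by simp [basisVec]
  have hdiv : ∀ x, divergence (fun x => φ x • (basisVec j : E d)) x =
      fderiv ℝ φ x (basisVec j) := by
    intro x
    have hd : DifferentiableAt ℝ φ x := h1.differentiable one_ne_zero x
    rw [divergence, Finset.sum_eq_single j]
    · rw [fderiv_smul_const hd]
      simp [basisVec]
    · intro i _ hij
      rw [fderiv_smul_const hd]
      simp [basisVec, hij]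
    · simp
  have hsub : Function.support (fun x => φ x • (basisVec j : E d)) ⊆ Function.support φ := by
    intro x hx h
    exact hx (by simp only [h, zero_smul])
  rw [perimeter_ofSet]
  refine le_iSup_of_le (fun x => φ x • basisVec j) (le_iSup_of_le (by fun_prop) (le_iSup_of_le
    (h2.mono hsub) (le_iSup_of_le ((closure_mono hsub).trans h3) (le_iSup_of_le (fun x => ?_) ?_))))
  · rw [norm_smul, hnorm, mul_one]
    exact h4 x
  · simp only [hdiv, le_refl]

/-- The coordinates of a test field are scalar test functions. -/
theorem perimeter_le_anisoPerimeter (U : Set (E d)) (A : MSet d) :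
    perimeter U A ≤ anisoPerimeter U A := by
  obtain ⟨A, hA, rfl⟩ := A.exists_ofSet
  rw [perimeter_ofSet]
  refine iSup_le fun φ => iSup_le fun h1 => iSup_le fun h2 => iSup_le fun h3 => iSup_le fun h4 => ?_
  have hφj : ∀ j : Fin d, ContDiff ℝ 1 fun x => φ x j := fun j =>
    (EuclideanSpace.proj (𝕜 := ℝ) j).contDiff.comp h1
  have hsub : ∀ j : Fin d, Function.support (fun x => φ x j) ⊆ Function.support φ := by
    intro j x hx h
    exact hx (by simp only [h]; rfl)
  have hcs : ∀ j : Fin d, HasCompactSupport fun x => φ x j := fun j => h2.mono (hsub j)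
  have hdiv : ∀ x, divergence φ x = ∑ j, fderiv ℝ (fun x => φ x j) x (basisVec j) := by
    intro x
    refine Finset.sum_congr rfl fun j _ => ?_
    have hd : HasFDerivAt φ (fderiv ℝ φ x) x := (h1.differentiable one_ne_zero x).hasFDerivAt
    have h := ((EuclideanSpace.proj j : E d →L[ℝ] ℝ).hasFDerivAt.comp x
      hd).fderiv
    have h' : ((EuclideanSpace.proj j : E d →L[ℝ] ℝ) ∘ φ) =
      fun x => φ x j := rfl
    rw [h'] at h
    rw [h]
    rfl
  simp only [hdiv]
  rw [integral_finsetSum]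
  · refine (Finset.le_sum_of_subadditive ENNReal.ofReal ENNReal.ofReal_zero.le
      (fun _ _ => ENNReal.ofReal_add_le) _ _).trans (Finset.sum_le_sum fun j _ => ?_)
    refine ofReal_setIntegral_le_dirVariation _ hA (hφj j) (hcs j)
      ((closure_mono (hsub j)).trans h3) fun x => ?_
    exact (PiLp.norm_apply_le (φ x) j).trans (h4 x)
  · intro j _
    refine (Continuous.integrable_of_hasCompactSupport ?_ ?_).integrableOn
    · exact ((hφj j).continuous_fderiv one_ne_zero).clm_apply continuous_const
    · exact (hcs j).fderiv_apply ℝ _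

end Variation

/-! ### Cubes -/

section Cubes

variable {d : ℕ}

/-- The open cube `(a, b)^d`. -/
def openCube (d : ℕ) (a b : ℝ) : Set (E d) := {x | ∀ j, x j ∈ Set.Ioo a b}

theorem unitCube_eq (d : ℕ) : unitCube d = openCube d 0 1 := rfl

theorem openCube_eq_iInter (a b : ℝ) :
    openCube d a b = ⋂ j, (fun x : E d => x j) ⁻¹' Set.Ioo a b := by
  ext x; simp [openCube]

theorem isOpen_openCube (a b : ℝ) : IsOpen (openCube d a b) := by
  rw [openCube_eq_iInter]
  exact isOpen_iInter_of_finite fun j => isOpen_Ioo.preimage (by fun_prop)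

theorem convex_openCube (a b : ℝ) : Convex ℝ (openCube d a b) := by
  rw [openCube_eq_iInter]
  exact convex_iInter fun j =>
    (convex_Ioo a b).linear_preimage (EuclideanSpace.proj (𝕜 := ℝ) j).toLinearMap

theorem isBounded_openCube (a b : ℝ) : Bornology.IsBounded (openCube d a b) := by
  have h : Bornology.IsBounded (Set.univ.pi fun _ : Fin d => Set.Ioo a b) :=
    Bornology.IsBounded.pi fun _ => Metric.isBounded_Ioo a b
  have h' := (PiLp.antilipschitzWith_ofLp 2 (fun _ : Fin d => ℝ)).isBounded_preimage h
  exact h'.subset fun x hx => by simpa [openCube] using hx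

theorem volume_openCube (a b : ℝ) : volume (openCube d a b) = ENNReal.ofReal (b - a) ^ d := by
  have h := (EuclideanSpace.volume_preserving_symm_measurableEquiv_toLp (Fin d)).measure_preimage
    (s := Set.univ.pi fun _ => Set.Ioo a b)
    (MeasurableSet.univ_pi fun _ => measurableSet_Ioo).nullMeasurableSet
  rw [Real.volume_pi_Ioo] at h
  simp only [Finset.prod_const, Finset.card_univ, Fintype.card_fin] at h
  rw [← h]
  congr 1
  ext x
  simp [openCube]

@[simp] theorem volume_unitCube : volume (unitCube d) = 1 := by
  simp [unitCube_eq, volume_openCube]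

theorem isOpen_unitCube : IsOpen (unitCube d) := isOpen_openCube 0 1

theorem isBounded_unitCube : Bornology.IsBounded (unitCube d) := isBounded_openCube 0 1

/-- The translates of the unit cube, as observation windows. -/
def cubeWindow (x : E d) : Window d :=
  ⟨x +ᵥ unitCube d, isOpen_unitCube.vadd x, isBounded_unitCube.vadd x,
    ((convex_openCube 0 1).vadd x).addHaar_frontier volume⟩

end Cubes

/-! ### Moments of a stationary random measurable set -/

section Moments

variable {d : ℕ} {Ω : Type u} [MeasurableSpace Ω] {P : Measure Ω} {X : Ω → MSet d}

theorem IsStationaryRAMS.lintegral_translate (hX : IsStationaryRAMS P X) (t : E d)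
    {F : MSet d → ℝ≥0∞} (hF : Measurable F) :
    ∫⁻ ω, F ((X ω).translate t) ∂P = ∫⁻ ω, F (X ω) ∂P := by
  have h := (MSet.continuous_translate t).measurable.comp hX.measurable
  rw [← lintegral_map hF hX.measurable, ← hX.stationary t]
  exact (lintegral_map hF h).symm

theorem measurable_covMeasure_comp (hX : Measurable X) (y : E d) (W : Set (E d)) :
    Measurable fun ω => covMeasure y W (X ω) :=
  (measurable_covMeasure y W).comp hX

theorem measurable_shiftDist_comp (hX : Measurable X) (t : E d) {W : Set (E d)}
    (hW : Bornology.IsBounded W) : Measurable fun ω => shiftDist t W (X ω) :=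
  (continuous_shiftDist t hW).measurable.comp hX

/-- The measure `B ↦ 𝔼 𝓛^d(X ∩ (y + X) ∩ B)`. -/
def meanCovMeasure (P : Measure Ω) (X : Ω → MSet d) (y : E d) : Measure (E d) :=
  P.bind fun ω => volume.restrict ((X ω).rep ∩ (y +ᵥ (X ω).rep))

theorem meanCovMeasure_apply (hX : Measurable X) (y : E d) {B : Set (E d)}
    (hB : MeasurableSet B) :
    meanCovMeasure P X y B = ∫⁻ ω, covMeasure y B (X ω) ∂P := by
  have hκ : ∀ B : Set (E d), MeasurableSet B → ∀ ω,
      volume.restrict ((X ω).rep ∩ (y +ᵥ (X ω).rep)) B = covMeasure y B (X ω) := fun B hB ω => by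
    rw [Measure.restrict_apply hB, Set.inter_comm]
    rfl
  rw [meanCovMeasure, Measure.bind_apply hB]
  · exact lintegral_congr fun ω => hκ B hB ω
  · refine (Measure.measurable_of_measurable_coe _ fun B hB => ?_).aemeasurable
    simp only [hκ B hB]
    exact measurable_covMeasure_comp hX y B

theorem specificCov_eq (hX : Measurable X) (y : E d) :
    specificCov P X y = (∫⁻ ω, covMeasure y (unitCube d) (X ω) ∂P).toReal := by
  simp only [specificCov, localCov_eq]
  refine integral_toReal (measurable_covMeasure_comp hX y _).aemeasurable
    (Eventually.of_forall fun ω => ?_)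
  exact (covMeasure_le y _ _).trans_lt isBounded_unitCube.measure_lt_top

theorem specificCov_nonneg (hX : Measurable X) (y : E d) : 0 ≤ specificCov P X y := by
  rw [specificCov_eq hX]
  exact ENNReal.toReal_nonneg

variable [IsProbabilityMeasure P]

theorem meanCovMeasure_le (hX : Measurable X) (y : E d) {B : Set (E d)}
    (hB : MeasurableSet B) : meanCovMeasure P X y B ≤ volume B := by
  rw [meanCovMeasure_apply hX y hB]
  calc ∫⁻ ω, covMeasure y B (X ω) ∂P ≤ ∫⁻ _, volume B ∂P :=
        lintegral_mono fun ω => covMeasure_le y B _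
    _ = volume B := by simp

/-- By stationarity and the uniqueness of Haar measure, `B ↦ 𝔼 𝓛^d(X ∩ (y + X) ∩ B)` is a multiple
of Lebesgue measure. -/
theorem IsStationaryRAMS.lintegral_covMeasure (hX : IsStationaryRAMS P X) (y : E d)
    {B : Set (E d)} (hB : MeasurableSet B) :
    ∫⁻ ω, covMeasure y B (X ω) ∂P = ENNReal.ofReal (specificCov P X y) * volume B := by
  have hXm := hX.measurable
  set ν := meanCovMeasure P X y with hν
  have : IsFiniteMeasureOnCompacts ν := ⟨fun K hK =>
    (meanCovMeasure_le hXm y hK.measurableSet).trans_lt hK.measure_lt_top⟩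
  have : ν.IsAddLeftInvariant := ⟨fun t => by
    ext B hB
    rw [Measure.map_apply (measurable_const_add t) hB, meanCovMeasure_apply hXm y hB,
      meanCovMeasure_apply hXm y (measurable_const_add t hB),
      ← hX.lintegral_translate t (measurable_covMeasure y B)]
    refine lintegral_congr fun ω => ?_
    rw [← covMeasure_translate t]
    congr 1
    ext x
    simp [Set.mem_vadd_set_iff_neg_vadd_mem]⟩
  have h := Measure.isAddLeftInvariant_eq_smul ν (volume : Measure (E d))
  set c := ν.addHaarScalarFactor (volume : Measure (E d))
  have hc : ∀ B : Set (E d), MeasurableSet B → ∫⁻ ω, covMeasure y B (X ω) ∂P = c * volume B := by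
    intro B hB
    rw [← meanCovMeasure_apply hXm y hB, ← hν, h]
    rfl
  rw [specificCov_eq hXm, hc _ hB, hc _ isOpen_unitCube.measurableSet]
  simp

theorem IsStationaryRAMS.integral_localCov (hX : IsStationaryRAMS P X) (y : E d)
    {W : Set (E d)} (hW : IsOpen W) (hWb : Bornology.IsBounded W) :
    ∫ ω, localCov y W (X ω) ∂P = specificCov P X y * volume.real W := by
  simp only [localCov_eq]
  rw [integral_toReal (measurable_covMeasure_comp hX.measurable y _).aemeasurable
    (Eventually.of_forall fun ω => (covMeasure_le y _ _).trans_lt hWb.measure_lt_top)]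
  have h := hX.lintegral_covMeasure y hW.measurableSet
  rw [h, ENNReal.toReal_mul, ENNReal.toReal_ofReal (specificCov_nonneg hX.measurable y)]
  rfl

theorem integrable_localCov (hX : Measurable X) (y : E d) {W : Set (E d)}
    (hWb : Bornology.IsBounded W) : Integrable (fun ω => localCov y W (X ω)) P := by
  simp only [localCov_eq]
  refine Integrable.of_bound
    (measurable_covMeasure_comp hX y W).ennreal_toReal.aestronglyMeasurable
    (volume.real W) (Eventually.of_forall fun ω => ?_)
  rw [Real.norm_of_nonneg ENNReal.toReal_nonneg]
  exact ENNReal.toReal_mono hWb.measure_lt_top.ne (covMeasure_le y W _)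

theorem IsStationaryRAMS.isAdmissible (hX : IsStationaryRAMS P X) :
    IsAdmissible (specificCov P X) := by
  intro q _ a y W c h
  have h1 : ∫ ω, (c + ∑ i, a i * localCov (y i) (W i).1 (X ω)) ∂P =
      c + ∑ i, a i * (specificCov P X (y i) * volume.real (W i).1) := by
    have hi : ∀ i, Integrable (fun ω => a i * localCov (y i) (W i).1 (X ω)) P := fun i =>
      (integrable_localCov hX.measurable (y i) (W i).2.2.1).const_mul _
    rw [integral_add (integrable_const c) (integrable_finsetSum _ fun i _ => hi i),
      integral_finsetSum _ fun i _ => hi i]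
    simp only [integral_const, probReal_univ, one_smul, integral_const_mul]
    congr 1
    exact Finset.sum_congr rfl fun i _ => by
      rw [hX.integral_localCov (y i) (W i).2.1 (W i).2.2.1]
  rw [← h1]
  exact integral_nonneg fun ω => h (X ω)

theorem IsStationaryRAMS.lintegral_shiftDist_add (hX : IsStationaryRAMS P X) (t : E d)
    {W : Set (E d)} (hW : IsOpen W) (hWb : Bornology.IsBounded W) :
    ∫⁻ ω, shiftDist t W (X ω) ∂P + 2 * (ENNReal.ofReal (specificCov P X t) * volume W) =
      2 * (ENNReal.ofReal (specificCov P X 0) * volume W) := by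
  have hm : Measurable fun ω => covMeasure 0 W (X ω) :=
    measurable_covMeasure_comp hX.measurable 0 W
  rw [← hX.lintegral_covMeasure t hW.measurableSet, ← hX.lintegral_covMeasure 0 hW.measurableSet,
    ← lintegral_const_mul' _ _ (by simp), ← lintegral_add_left
      (measurable_shiftDist_comp hX.measurable t hWb)]
  simp only [shiftDist_add_two_mul_covMeasure t hW.measurableSet]
  rw [lintegral_add_left hm, hX.lintegral_translate t (measurable_covMeasure 0 W), two_mul]

theorem IsStationaryRAMS.specificCov_le_zero (hX : IsStationaryRAMS P X) (t : E d) :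
    specificCov P X t ≤ specificCov P X 0 := by
  have h := hX.lintegral_shiftDist_add t isOpen_unitCube isBounded_unitCube
  rw [volume_unitCube, mul_one, mul_one] at h
  have h1 : 2 * ENNReal.ofReal (specificCov P X t) ≤ 2 * ENNReal.ofReal (specificCov P X 0) := by
    rw [← h]; exact le_add_self
  have h2 := (ENNReal.mul_le_mul_iff_right two_ne_zero (by simp)).1 h1
  exact (ENNReal.ofReal_le_ofReal_iff (specificCov_nonneg hX.measurable 0)).1 h2

/-- `𝔼 𝓛^d((X ∆ (t + X)) ∩ W) = 2 (γ^s(0) - γ^s(t)) 𝓛^d(W)`. -/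
theorem IsStationaryRAMS.lintegral_shiftDist (hX : IsStationaryRAMS P X) (t : E d)
    {W : Set (E d)} (hW : IsOpen W) (hWb : Bornology.IsBounded W) :
    ∫⁻ ω, shiftDist t W (X ω) ∂P =
      ENNReal.ofReal (2 * (specificCov P X 0 - specificCov P X t)) * volume W := by
  have h := hX.lintegral_shiftDist_add t hW hWb
  have hle := hX.specificCov_le_zero t
  have h0 := specificCov_nonneg (P := P) hX.measurable t
  have hfin : 2 * (ENNReal.ofReal (specificCov P X t) * volume W) ≠ ⊤ :=
    ENNReal.mul_ne_top (by simp) (ENNReal.mul_ne_top ENNReal.ofReal_ne_top hWb.measure_lt_top.ne)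
  refine (ENNReal.add_left_inj hfin).1 (h.trans ?_)
  have h2 : ENNReal.ofReal (specificCov P X 0) =
      ENNReal.ofReal (specificCov P X 0 - specificCov P X t) +
        ENNReal.ofReal (specificCov P X t) := by
    rw [← ENNReal.ofReal_add (by linarith) h0, sub_add_cancel]
  rw [h2, ENNReal.ofReal_mul zero_le_two, ENNReal.ofReal_ofNat]
  ring

theorem shiftDist_add_le (s t : E d) (W : Set (E d)) (A : MSet d) :
    shiftDist (s + t) W A ≤ shiftDist s W A + shiftDist t W (A.translate s) := by
  have h := locDist_triangle W A (A.translate s) (A.translate (s + t))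
  rwa [shiftDist, shiftDist, shiftDist, MSet.translate_translate, add_comm t s]

theorem IsStationaryRAMS.two_mul_sub_specificCov_add_le (hX : IsStationaryRAMS P X) (s t : E d) :
    2 * (specificCov P X 0 - specificCov P X (s + t)) ≤
      2 * (specificCov P X 0 - specificCov P X s) +
        2 * (specificCov P X 0 - specificCov P X t) := by
  have hs := hX.specificCov_le_zero s
  have ht := hX.specificCov_le_zero t
  have h : ∫⁻ ω, shiftDist (s + t) (unitCube d) (X ω) ∂P ≤
      ∫⁻ ω, shiftDist s (unitCube d) (X ω) ∂P + ∫⁻ ω, shiftDist t (unitCube d) (X ω) ∂P := by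
    rw [← hX.lintegral_translate s (continuous_shiftDist t isBounded_unitCube).measurable,
      ← lintegral_add_left (measurable_shiftDist_comp hX.measurable s isBounded_unitCube)]
    exact lintegral_mono fun ω => shiftDist_add_le s t _ _
  simp only [hX.lintegral_shiftDist _ isOpen_unitCube isBounded_unitCube, volume_unitCube,
    mul_one] at h
  rw [← ENNReal.ofReal_add (by linarith) (by linarith)] at h
  exact (ENNReal.ofReal_le_ofReal_iff (by linarith)).1 h

theorem IsStationaryRAMS.two_mul_sub_specificCov_nsmul_le (hX : IsStationaryRAMS P X) (n : ℕ)
    (t : E d) :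
    2 * (specificCov P X 0 - specificCov P X (n • t)) ≤
      n * (2 * (specificCov P X 0 - specificCov P X t)) := by
  induction n with
  | zero => simp
  | succ n ih =>
    rw [succ_nsmul]
    have := hX.two_mul_sub_specificCov_add_le (n • t) t
    push_cast
    linarith

/-! ### The mean directional variation is twice the Lipschitz constant of the covariogram -/

theorem IsStationaryRAMS.ofReal_sub_specificCov_le (hX : IsStationaryRAMS P X) (j : Fin d)
    (t : ℝ) :
    ENNReal.ofReal (2 * (specificCov P X 0 - specificCov P X (t • basisVec j))) ≤
      ENNReal.ofReal |t| * ∫⁻ ω, dirVariation (basisVec j) (unitCube d) (X ω) ∂P := by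
  set I := ∫⁻ ω, dirVariation (basisVec j) (unitCube d) (X ω) ∂P with hI
  set f : E d → ℝ := fun t => 2 * (specificCov P X 0 - specificCov P X t) with hf
  -- the increments along short translations, observed in a slightly smaller cube, are controlled
  -- by the variation; subadditivity then gives arbitrary translations
  have key : ∀ ε : ℝ, 0 < ε → ENNReal.ofReal (f (t • basisVec j)) * ENNReal.ofReal (1 - ε - ε) ^ d
      ≤ ENNReal.ofReal |t| * I := by
    intro ε hε
    obtain ⟨n, hn⟩ := exists_nat_gt (|t| / ε)
    have hn0 : (0 : ℝ) < n := lt_of_le_of_lt (by positivity) hn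
    set s : ℝ := t / n with hs
    have hsε : |s| < ε := by
      rw [hs, abs_div, Nat.abs_cast, div_lt_iff₀ hn0]
      rwa [div_lt_iff₀ hε, mul_comm] at hn
    have hns : n • (s • basisVec j : E d) = t • basisVec j := by
      rw [← Nat.cast_smul_eq_nsmul ℝ, smul_smul, hs, mul_div_cancel₀ _ hn0.ne']
    have h1 : ENNReal.ofReal (f (s • basisVec j)) * ENNReal.ofReal (1 - ε - ε) ^ d ≤
        ENNReal.ofReal |s| * I := by
      rw [← volume_openCube, hf, ← hX.lintegral_shiftDist _ (isOpen_openCube _ _)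
        (isBounded_openCube _ _), hI, ← lintegral_const_mul' _ _ ENNReal.ofReal_ne_top]
      refine lintegral_mono fun ω => shiftDist_smul_le _ _ (isOpen_openCube _ _)
        (isBounded_openCube _ _) (fun x hx v hv i => ?_) _
      have hv' : |v| ≤ |s| := by
        simpa using Set.abs_sub_left_of_mem_uIcc hv
      have hvi : |v * (basisVec j : E d) i| ≤ |s| := by
        rw [abs_mul]
        refine (mul_le_of_le_one_right (abs_nonneg v) ?_).trans hv'
        by_cases hij : i = j <;> simp [basisVec, hij]
      have hxi := hx i
      have := abs_le.1 hvi
      simp only [PiLp.sub_apply, PiLp.smul_apply, smul_eq_mul, Set.mem_Ioo] at hxi ⊢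
      constructor <;> linarith [hxi.1, hxi.2]
    have h2 : ENNReal.ofReal (f (t • basisVec j)) ≤
        ENNReal.ofReal n * ENNReal.ofReal (f (s • basisVec j)) := by
      rw [← ENNReal.ofReal_mul hn0.le, ← hns]
      exact ENNReal.ofReal_le_ofReal (hX.two_mul_sub_specificCov_nsmul_le n _)
    calc ENNReal.ofReal (f (t • basisVec j)) * ENNReal.ofReal (1 - ε - ε) ^ d
        ≤ ENNReal.ofReal n * ENNReal.ofReal (f (s • basisVec j)) *
            ENNReal.ofReal (1 - ε - ε) ^ d := by gcongr
      _ = ENNReal.ofReal n * (ENNReal.ofReal (f (s • basisVec j)) *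
            ENNReal.ofReal (1 - ε - ε) ^ d) := by ring
      _ ≤ ENNReal.ofReal n * (ENNReal.ofReal |s| * I) := by gcongr
      _ = ENNReal.ofReal |t| * I := by
        rw [← mul_assoc, ← ENNReal.ofReal_mul hn0.le, hs, abs_div, Nat.abs_cast,
          mul_div_cancel₀ _ hn0.ne']
  have hlim : Tendsto (fun ε : ℝ => ENNReal.ofReal (f (t • basisVec j)) *
      ENNReal.ofReal (1 - ε - ε) ^ d) (𝓝[>] 0) (𝓝 (ENNReal.ofReal (f (t • basisVec j)))) := by
    have h1 : Tendsto (fun ε : ℝ => ENNReal.ofReal (1 - ε - ε) ^ d) (𝓝[>] 0) (𝓝 1) := by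
      have : Continuous fun ε : ℝ => ENNReal.ofReal (1 - ε - ε) ^ d :=
        (ENNReal.continuous_pow d).comp (ENNReal.continuous_ofReal.comp (by fun_prop))
      have h := (this.tendsto 0).mono_left (nhdsWithin_le_nhds (s := Set.Ioi 0))
      simpa using h
    simpa using ENNReal.Tendsto.const_mul h1 (Or.inr ENNReal.ofReal_ne_top)
  exact le_of_tendsto hlim (eventually_mem_nhdsWithin.mono fun ε hε => key ε hε)

theorem IsStationaryRAMS.two_mul_lipAt_le (hX : IsStationaryRAMS P X) (j : Fin d) :
    2 * lipAt j (specificCov P X) 0 ≤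
      ∫⁻ ω, dirVariation (basisVec j) (unitCube d) (X ω) ∂P := by
  rw [lipAt, ENNReal.mul_iSup]
  refine iSup_le fun t => ?_
  rw [ENNReal.mul_iSup]
  refine iSup_le fun ht => ?_
  have ht' : 0 < |t| := abs_pos.2 ht
  have h := hX.ofReal_sub_specificCov_le j t
  have hle := hX.specificCov_le_zero (t • basisVec j)
  rw [zero_add, abs_sub_comm, abs_of_nonneg (by linarith)]
  have h2 : ENNReal.ofReal (2 * (specificCov P X 0 - specificCov P X (t • basisVec j)) / |t|) =
      2 * ENNReal.ofReal ((specificCov P X 0 - specificCov P X (t • basisVec j)) / |t|) := by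
    rw [mul_div_assoc, ENNReal.ofReal_mul zero_le_two, ENNReal.ofReal_ofNat]
  rw [← h2, ENNReal.ofReal_div_of_pos ht']
  exact ENNReal.div_le_of_le_mul' h

/-- The lower integral is superadditive, whether or not the functions are measurable. -/
theorem sum_lintegral_le_lintegral_sum {ι : Type*} (s : Finset ι) (f : ι → Ω → ℝ≥0∞) :
    ∑ i ∈ s, ∫⁻ ω, f i ω ∂P ≤ ∫⁻ ω, ∑ i ∈ s, f i ω ∂P := by
  classical
  induction s using Finset.induction_on with
  | empty => simp
  | insert i s hi ih =>
    simp only [Finset.sum_insert hi]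
    exact (add_le_add le_rfl ih).trans (le_lintegral_add _ _)

theorem IsStationaryRAMS.two_mul_sum_lipAt_le (hX : IsStationaryRAMS P X) :
    2 * ∑ j : Fin d, lipAt j (specificCov P X) 0 ≤ specificAnisoPer P X := by
  rw [Finset.mul_sum]
  exact (Finset.sum_le_sum fun j _ => hX.two_mul_lipAt_le j).trans
    (sum_lintegral_le_lintegral_sum _ _)

/-- Fatou's lemma, applied to the difference quotients along `1 / (n + 1)`. -/
theorem IsStationaryRAMS.specificAnisoPer_le (hX : IsStationaryRAMS P X) :
    specificAnisoPer P X ≤ 2 * ∑ j : Fin d, lipAt j (specificCov P X) 0 := by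
  set τ : ℕ → ℝ := fun n => 1 / ((n : ℝ) + 1) with hτ
  have hτ0 : ∀ n, 0 < τ n := fun n => by positivity
  set g : Fin d → ℕ → Ω → ℝ≥0∞ := fun j n ω =>
    ENNReal.ofReal (τ n)⁻¹ * shiftDist (τ n • basisVec j) (unitCube d) (X ω) with hg
  have hgm : ∀ j n, Measurable (g j n) := fun j n =>
    (measurable_shiftDist_comp hX.measurable _ isBounded_unitCube).const_mul _
  calc specificAnisoPer P X ≤ ∫⁻ ω, ∑ j : Fin d, liminf (fun n => g j n ω) atTop ∂P :=
        lintegral_mono fun ω => Finset.sum_le_sum fun j _ =>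
          dirVariation_le_liminf _ isOpen_unitCube isBounded_unitCube hτ0
            tendsto_one_div_add_atTop_nhds_zero_nat _
    _ = ∑ j : Fin d, ∫⁻ ω, liminf (fun n => g j n ω) atTop ∂P :=
        lintegral_finsetSum _ fun j _ => Measurable.liminf (hgm j)
    _ ≤ ∑ j : Fin d, 2 * lipAt j (specificCov P X) 0 := by
        refine Finset.sum_le_sum fun j _ => (lintegral_liminf_le (hgm j)).trans ?_
        refine liminf_le_of_frequently_le' (Frequently.of_forall fun n => ?_)
        have hle := hX.specificCov_le_zero (τ n • basisVec j)
        rw [hg, lintegral_const_mul' _ _ ENNReal.ofReal_ne_top,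
          hX.lintegral_shiftDist _ isOpen_unitCube isBounded_unitCube, volume_unitCube, mul_one,
          ENNReal.ofReal_mul zero_le_two, ENNReal.ofReal_ofNat, mul_left_comm,
          ← ENNReal.ofReal_mul (inv_nonneg.2 (hτ0 n).le)]
        gcongr
        refine le_iSup_of_le (τ n) (le_iSup_of_le (hτ0 n).ne' ?_)
        rw [zero_add, abs_sub_comm, abs_of_nonneg (by linarith), abs_of_pos (hτ0 n),
          div_eq_inv_mul]
    _ = 2 * ∑ j : Fin d, lipAt j (specificCov P X) 0 := by rw [Finset.mul_sum]

theorem specificPer_le_specificAnisoPer (P : Measure Ω) (X : Ω → MSet d) :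
    specificPer P X ≤ specificAnisoPer P X :=
  lintegral_mono fun _ => perimeter_le_anisoPerimeter _ _

theorem IsStationaryRAMS.two_mul_lipAt_le_specificPer (hX : IsStationaryRAMS P X) (j : Fin d) :
    2 * lipAt j (specificCov P X) 0 ≤ specificPer P X :=
  (hX.two_mul_lipAt_le j).trans (lintegral_mono fun _ => dirVariation_basisVec_le_perimeter _ _ _)

end Moments

/-! ### Invariant positive extension of a functional -/

section Extension

variable {V ι : Type*} [AddCommGroup V] [Module ℝ V]

/-- The ergodic average `(1 + T + ⋯ + T^N) / (N + 1)`. -/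
def ergodicAverage (T : Module.End ℝ V) (N : ℕ) : Module.End ℝ V :=
  ((N : ℝ) + 1)⁻¹ • ∑ n ∈ Finset.range (N + 1), T ^ n

theorem ergodicAverage_apply (T : Module.End ℝ V) (N : ℕ) (v : V) :
    ergodicAverage T N v = ((N : ℝ) + 1)⁻¹ • ∑ n ∈ Finset.range (N + 1), (T ^ n) v := by
  simp [ergodicAverage, LinearMap.sum_apply]

theorem commute_ergodicAverage {S T : Module.End ℝ V} (h : Commute S T) (M N : ℕ) :
    Commute (ergodicAverage S M) (ergodicAverage T N) :=
  ((Commute.sum_left _ _ _ fun m _ => Commute.sum_right _ _ _ fun n _ =>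
    h.pow_pow m n).smul_left _).smul_right _

theorem ergodicAverage_sub (T : Module.End ℝ V) (N : ℕ) (v : V) :
    ergodicAverage T N (T v - v) = ((N : ℝ) + 1)⁻¹ • ((T ^ (N + 1)) v - v) := by
  rw [ergodicAverage_apply]
  congr 1
  have h : ∀ n, (T ^ n) (T v - v) = (T ^ (n + 1)) v - (T ^ n) v := fun n => by
    rw [map_sub, pow_succ]; rfl
  simp only [h]
  rw [Finset.sum_range_sub (fun n => (T ^ n) v)]
  simp

variable [PartialOrder V] [IsOrderedAddMonoid V] [PosSMulMono ℝ V]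

/-- Composites of ergodic averages of the operators `T i`. -/
def averages (T : ι → Module.End ℝ V) : Submonoid (Module.End ℝ V) :=
  Submonoid.closure {M | ∃ i N, M = ergodicAverage (T i) N}


/-- **Invariant positive extension.** A positive functional, given by its graph `Γ` on a subspace
containing an order unit `e`, and invariant under commuting positive operators that fix `e`, extends
to a positive functional invariant under these operators. It is obtained from the Hahn–Banach
theorem, for the sublinear functional
`v ↦ inf {r | M v ≤ f for some average M and some (f, r) ∈ Γ}`. -/
theorem exists_invariant_positive_extension {e : V} (he : ∀ v : V, ∃ C : ℝ, v ≤ C • e)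
    {T : ι → Module.End ℝ V} (hcomm : ∀ i j, Commute (T i) (T j))
    (hpos : ∀ i v, 0 ≤ v → 0 ≤ T i v) (hTe : ∀ i, T i e = e)
    {Γ : Submodule ℝ (V × ℝ)} (heΓ : (e, 1) ∈ Γ) (hΓpos : ∀ f r, (f, r) ∈ Γ → 0 ≤ f → 0 ≤ r)
    (hΓT : ∀ i f r, (f, r) ∈ Γ → (T i f, r) ∈ Γ) :
    ∃ L : V →ₗ[ℝ] ℝ, (∀ v, 0 ≤ v → 0 ≤ L v) ∧ (∀ f r, (f, r) ∈ Γ → L f = r) ∧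
      ∀ i v, L (T i v) = L v := by
  have hceΓ : ∀ c : ℝ, (c • e, c) ∈ Γ := fun c => by simpa using Γ.smul_mem c heΓ
  have hpow_pos : ∀ i (n : ℕ) v, 0 ≤ v → 0 ≤ (T i ^ n) v := by
    intro i n
    induction n with
    | zero => intro v hv; simpa using hv
    | succ n ih => intro v hv; rw [pow_succ]; exact ih _ (hpos i v hv)
  have hpow_e : ∀ i (n : ℕ), (T i ^ n) e = e := by
    intro i n
    induction n with
    | zero => simp
    | succ n ih => rw [pow_succ, Module.End.mul_apply, hTe, ih]
  have hpow_Γ : ∀ i (n : ℕ) f r, (f, r) ∈ Γ → ((T i ^ n) f, r) ∈ Γ := by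
    intro i n
    induction n with
    | zero => intro f r h; simpa using h
    | succ n ih => intro f r h; rw [pow_succ]; exact ih _ _ (hΓT i f r h)
  have hA : ∀ M ∈ averages T, (∀ v, 0 ≤ v → 0 ≤ M v) ∧ M e = e ∧
      ∀ f r, (f, r) ∈ Γ → (M f, r) ∈ Γ := by
    intro M hM
    induction hM using Submonoid.closure_induction with
    | mem M hM =>
      obtain ⟨i, N, rfl⟩ := hM
      have hN : ((N : ℝ) + 1)⁻¹ * ((N : ℝ) + 1) = 1 := inv_mul_cancel₀ (by positivity)
      refine ⟨fun v hv => ?_, ?_, fun f r h => ?_⟩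
      · rw [ergodicAverage_apply]
        exact smul_nonneg (by positivity) (Finset.sum_nonneg fun n _ => hpow_pos i n v hv)
      · rw [ergodicAverage_apply]
        simp only [hpow_e, Finset.sum_const, Finset.card_range]
        rw [← Nat.cast_smul_eq_nsmul ℝ, smul_smul]
        push_cast
        rw [hN, one_smul]
      · have h1 := Γ.smul_mem ((N : ℝ) + 1)⁻¹
          (Γ.sum_mem fun n (_ : n ∈ Finset.range (N + 1)) => hpow_Γ i n f r h)
        convert h1 using 1
        ext
        · rw [ergodicAverage_apply]; simp [Prod.fst_sum]
        · simp only [Prod.smul_snd, Prod.snd_sum, Finset.sum_const, Finset.card_range,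
            smul_eq_mul, nsmul_eq_mul]
          push_cast
          rw [← mul_assoc, hN, one_mul]
    | one => exact ⟨fun v hv => hv, rfl, fun f r h => h⟩
    | mul M N _ _ hM hN =>
      exact ⟨fun v hv => hM.1 _ (hN.1 v hv), by rw [Module.End.mul_apply, hN.2.1, hM.2.1],
        fun f r h => hM.2.2 _ _ (hN.2.2 _ _ h)⟩
  have hAmono : ∀ M ∈ averages T, ∀ v w, v ≤ w → M v ≤ M w := fun M hM v w h => by
    have := (hA M hM).1 (w - v) (sub_nonneg.2 h)
    rwa [map_sub, sub_nonneg] at this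
  have hAcomm : ∀ M ∈ averages T, ∀ N ∈ averages T, Commute M N := by
    intro M hM N hN
    induction hM, hN using Submonoid.closure_induction₂ with
    | mem M N hM hN =>
      obtain ⟨i, m, rfl⟩ := hM
      obtain ⟨j, n, rfl⟩ := hN
      exact commute_ergodicAverage (hcomm i j) m n
    | one_left => exact Commute.one_left _
    | one_right => exact Commute.one_right _
    | mul_left _ _ _ _ _ _ h1 h2 => exact h1.mul_left h2
    | mul_right _ _ _ _ _ _ h1 h2 => exact h1.mul_right h2
  set S : V → Set ℝ := fun v => {r | ∃ M ∈ averages T, ∃ f, (f, r) ∈ Γ ∧ M v ≤ f} with hS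
  have hSne : ∀ v, (S v).Nonempty := fun v => by
    obtain ⟨C, hC⟩ := he v
    exact ⟨C, 1, one_mem _, C • e, hceΓ C, hC⟩
  have hSbdd : ∀ v, BddBelow (S v) := fun v => by
    obtain ⟨C, hC⟩ := he (-v)
    refine ⟨-C, ?_⟩
    rintro r ⟨M, hM, f, hf, hMf⟩
    have h1 : -(C • e) ≤ M v := by
      have := hAmono M hM _ _ (neg_le.1 hC)
      rwa [map_neg, map_smul, (hA M hM).2.1] at this
    have h2 := hΓpos (f + C • e) (r + C) (Γ.add_mem hf (hceΓ C))
      (by rw [← neg_le_iff_add_nonneg]; exact h1.trans hMf)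
    linarith
  set p : V → ℝ := fun v => sInf (S v) with hp
  have hple : ∀ v, ∀ r ∈ S v, p v ≤ r := fun v r hr => csInf_le (hSbdd v) hr
  have hp_smul_le : ∀ c : ℝ, 0 < c → ∀ v, p (c • v) ≤ c * p v := by
    intro c hc v
    rw [← div_le_iff₀' hc]
    refine le_csInf (hSne v) ?_
    rintro r ⟨M, hM, f, hf, hMf⟩
    rw [div_le_iff₀' hc]
    refine hple _ _ ⟨M, hM, c • f, by simpa using Γ.smul_mem c hf, ?_⟩
    rw [map_smul]
    exact smul_le_smul_of_nonneg_left hMf hc.le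
  have hp_hom : ∀ c : ℝ, 0 < c → ∀ v, p (c • v) = c * p v := by
    intro c hc v
    refine le_antisymm (hp_smul_le c hc v) ?_
    have := hp_smul_le c⁻¹ (inv_pos.2 hc) (c • v)
    rw [smul_smul, inv_mul_cancel₀ hc.ne', one_smul] at this
    rwa [← le_inv_mul_iff₀ hc]
  have hp_add : ∀ v w, p (v + w) ≤ p v + p w := by
    intro v w
    rw [← sub_le_iff_le_add]
    refine le_csInf (hSne v) ?_
    rintro r ⟨M, hM, f, hf, hMf⟩
    rw [sub_le_comm]
    refine le_csInf (hSne w) ?_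
    rintro s ⟨N, hN, g, hg, hNg⟩
    rw [sub_le_iff_le_add]
    -- the composite average `M N = N M` serves both vectors
    refine hple _ _ ⟨M * N, mul_mem hM hN, M g + N f,
      Γ.add_mem ((hA M hM).2.2 _ _ hg) ((hA N hN).2.2 _ _ hf), ?_⟩
    rw [map_add, add_comm]
    refine add_le_add (hAmono M hM _ _ hNg) ?_
    rw [(hAcomm M hM N hN).eq]
    exact hAmono N hN _ _ hMf
  obtain ⟨L, -, hL⟩ := exists_extension_of_le_sublinear (⊥ : V →ₗ.[ℝ] ℝ) p hp_hom hp_add (by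
    rintro ⟨x, hx⟩
    have hx0 : x = 0 := (Submodule.mem_bot ℝ).1 hx
    subst hx0
    have h0 : (⊥ : V →ₗ.[ℝ] ℝ) ⟨0, hx⟩ = 0 := (⊥ : V →ₗ.[ℝ] ℝ).map_zero
    rw [h0]
    refine Real.sInf_nonneg ?_
    rintro r ⟨M, hM, f, hf, hMf⟩
    rw [map_zero] at hMf
    exact hΓpos f r hf hMf)
  have hLΓ : ∀ f r, (f, r) ∈ Γ → L f ≤ r := fun f r h =>
    (hL f).trans (hple f r ⟨1, one_mem _, f, h, le_rfl⟩)
  have hLT : ∀ i v, L (T i v) ≤ L v := by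
    intro i v
    obtain ⟨C, hC⟩ := he v
    obtain ⟨C', hC'⟩ := he (-v)
    -- the ergodic averages of `T v - v` telescope
    have hN : ∀ N : ℕ, L (T i v - v) ≤ (C + C') * ((N : ℝ) + 1)⁻¹ := by
      intro N
      refine (hL _).trans (hple _ _ ⟨ergodicAverage (T i) N, Submonoid.subset_closure ⟨i, N, rfl⟩,
        _, hceΓ _, ?_⟩)
      rw [ergodicAverage_sub, mul_comm, mul_smul]
      refine smul_le_smul_of_nonneg_left ?_ (by positivity)
      rw [sub_eq_add_neg, add_smul]
      refine add_le_add ?_ hC'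
      have := hpow_pos i (N + 1) (C • e - v) (sub_nonneg.2 hC)
      rwa [map_sub, map_smul, hpow_e, sub_nonneg] at this
    have hlim : Tendsto (fun N : ℕ => (C + C') * ((N : ℝ) + 1)⁻¹) atTop (𝓝 0) := by
      have := (tendsto_one_div_add_atTop_nhds_zero_nat (𝕜 := ℝ)).const_mul (C + C')
      simpa using this
    have h := ge_of_tendsto' hlim hN
    rw [map_sub] at h
    linarith
  refine ⟨L, fun v hv => ?_, fun f r h => le_antisymm (hLΓ f r h) ?_,
    fun i v => le_antisymm (hLT i v) ?_⟩
  · have h := (hL (-v)).trans (hple (-v) 0 ⟨1, one_mem _, 0, Γ.zero_mem, by simpa using hv⟩)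
    rw [map_neg] at h
    linarith
  · have h := hLΓ (-f) (-r) (Γ.neg_mem h)
    rw [map_neg] at h
    linarith
  · have h := hLT i (-v)
    rw [map_neg, map_neg, map_neg] at h
    linarith

end Extension

section Representation

variable {K : Type*} [TopologicalSpace K] [CompactSpace K] [T2Space K] [MeasurableSpace K]
  [BorelSpace K]

/-- The Riesz–Markov–Kakutani theorem on a compact space, for normalized functionals. -/
theorem exists_probability_of_positive (L : C(K, ℝ) →ₗ[ℝ] ℝ) (hL : ∀ f, 0 ≤ f → 0 ≤ L f)
    (hL1 : L 1 = 1) :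
    ∃ μ : Measure K, IsProbabilityMeasure μ ∧ μ.Regular ∧ ∀ f : C(K, ℝ), ∫ x, f x ∂μ = L f := by
  let Λ₀ : CompactlySupportedContinuousMap K ℝ →ₗ[ℝ] ℝ :=
    { toFun := fun f => L f.toContinuousMap
      map_add' := fun f g => L.map_add f.toContinuousMap g.toContinuousMap
      map_smul' := fun c f => L.map_smul c f.toContinuousMap }
  let Λ : CompactlySupportedContinuousMap K ℝ →ₚ[ℝ] ℝ :=
    PositiveLinearMap.mk₀ Λ₀ fun f hf => hL f.toContinuousMap fun x => hf x
  have hint : ∀ f : C(K, ℝ), ∫ x, f x ∂(RealRMK.rieszMeasure Λ) = L f := fun f =>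
    RealRMK.integral_rieszMeasure Λ (CompactlySupportedContinuousMap.continuousMapEquiv f)
  refine ⟨RealRMK.rieszMeasure Λ, ?_, inferInstance, hint⟩
  have h1 := hint 1
  rw [hL1] at h1
  simp only [ContinuousMap.one_apply, integral_const, smul_eq_mul, mul_one] at h1
  refine ⟨?_⟩
  rw [← ENNReal.toReal_eq_one_iff]
  exact h1

theorem map_eq_of_integral_eq {μ : Measure K} [IsFiniteMeasure μ] [μ.Regular] (T : K ≃ₜ K)
    (h : ∀ f : C(K, ℝ), ∫ x, f (T x) ∂μ = ∫ x, f x ∂μ) : μ.map T = μ := by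
  have : (μ.map T).Regular := Measure.Regular.map T
  refine Measure.ext_of_integral_eq_on_compactlySupported fun f => ?_
  rw [integral_map T.continuous.measurable.aemeasurable
    (map_continuous f).aestronglyMeasurable]
  exact h f.toContinuousMap

end Representation

/-! ### Stationary binary fields with prescribed covariances -/

section BinaryField

variable {d : ℕ}

/-- The compact space `{0, 1}^(ℝ^d)` of binary fields indexed by `ℝ^d`, with its Borel
sigma-algebra (which contains the product sigma-algebra, strictly if `d ≥ 1`). -/
def BinaryField (d : ℕ) : Type := E d → Bool

instance : TopologicalSpace (BinaryField d) := inferInstanceAs (TopologicalSpace (E d → Bool))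
instance : CompactSpace (BinaryField d) := inferInstanceAs (CompactSpace (E d → Bool))
instance : T2Space (BinaryField d) := inferInstanceAs (T2Space (E d → Bool))
instance : MeasurableSpace (BinaryField d) := borel (BinaryField d)
instance : BorelSpace (BinaryField d) := ⟨rfl⟩

/-- The value of a field at a point. -/
def BinaryField.eval (x : E d) (ω : BinaryField d) : Bool := ω x

theorem BinaryField.continuous_eval (x : E d) : Continuous (BinaryField.eval x) :=
  continuous_apply (A := fun _ : E d => Bool) x

/-- The translate `x ↦ ω (x - t)` of a field. -/
def BinaryField.shift (t : E d) : BinaryField d ≃ₜ BinaryField d where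
  toFun ω := fun x => ω (x - t)
  invFun ω := fun x => ω (x + t)
  left_inv ω := funext fun x => congrArg ω (add_sub_cancel_right x t)
  right_inv ω := funext fun x => congrArg ω (sub_add_cancel x t)
  continuous_toFun := continuous_pi fun x => BinaryField.continuous_eval (x - t)
  continuous_invFun := continuous_pi fun x => BinaryField.continuous_eval (x + t)

theorem BinaryField.eval_shift (t x : E d) (ω : BinaryField d) :
    (BinaryField.shift t ω).eval x = ω.eval (x - t) := rfl

theorem BinaryField.shift_shift (s t : E d) (ω : BinaryField d) :
    BinaryField.shift s (BinaryField.shift t ω) = BinaryField.shift t (BinaryField.shift s ω) := by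
  funext x
  change BinaryField.eval x _ = BinaryField.eval x _
  simp only [BinaryField.eval_shift, sub_right_comm]

/-- The product `ω(x) ω(y)`, as a continuous real function of the field `ω`. -/
def BinaryField.corr (x y : E d) : C(BinaryField d, ℝ) where
  toFun ω := if ω.eval x && ω.eval y then 1 else 0
  continuous_toFun := by
    have h : Continuous fun ω : BinaryField d => (ω.eval x && ω.eval y) :=
      (continuous_of_discreteTopology (f := fun p : Bool × Bool => p.1 && p.2)).comp
        ((BinaryField.continuous_eval x).prodMk (BinaryField.continuous_eval y))
    exact (continuous_of_discreteTopology (f := fun b : Bool => if b then (1 : ℝ) else 0)).comp h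

theorem BinaryField.corr_apply (x y : E d) (ω : BinaryField d) :
    BinaryField.corr x y ω = if ω.eval x && ω.eval y then 1 else 0 := rfl

/-- Composition with a translation, as an operator on continuous functions of the field. -/
def BinaryField.shiftOp (t : E d) : Module.End ℝ C(BinaryField d, ℝ) where
  toFun f := f.comp (BinaryField.shift t : C(BinaryField d, BinaryField d))
  map_add' _ _ := rfl
  map_smul' _ _ := rfl

theorem BinaryField.shiftOp_apply (t : E d) (f : C(BinaryField d, ℝ)) (ω : BinaryField d) :
    BinaryField.shiftOp t f ω = f (BinaryField.shift t ω) := rfl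

theorem BinaryField.shiftOp_corr (t x y : E d) :
    BinaryField.shiftOp t (BinaryField.corr x y) = BinaryField.corr (x - t) (y - t) := by
  rfl

open scoped Classical in
/-- The indicator field of a set. -/
def BinaryField.ofSet (B : Set (E d)) : BinaryField d := fun x => decide (x ∈ B)

theorem BinaryField.eval_ofSet (B : Set (E d)) (x : E d) :
    (BinaryField.ofSet B).eval x = true ↔ x ∈ B := by
  simp [BinaryField.ofSet, BinaryField.eval]

theorem BinaryField.corr_ofSet (x y z : E d) (B : Set (E d)) :
    BinaryField.corr x y (BinaryField.ofSet {x | x + z ∈ B}) =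
      {z | x + z ∈ B ∧ y + z ∈ B}.indicator (fun _ => (1 : ℝ)) z := by
  have hx := BinaryField.eval_ofSet {x | x + z ∈ B} x
  have hy := BinaryField.eval_ofSet {x | x + z ∈ B} y
  classical
  rw [BinaryField.corr_apply, Set.indicator_apply]
  refine if_congr ?_ rfl rfl
  rw [Bool.and_eq_true, hx, hy]
  rfl

/-- Admissibility, for families of constraints indexed by an arbitrary finite set. -/
theorem IsAdmissible.nonneg {S : E d → ℝ} (hS : IsAdmissible S) {ι : Type*} (s : Finset ι)
    (a : ι → ℝ) (y : ι → E d) (W : ι → Window d) (c : ℝ)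
    (h : ∀ A : MSet d, 0 ≤ c + ∑ i ∈ s, a i * localCov (y i) (W i).1 A) :
    0 ≤ c + ∑ i ∈ s, a i * (S (y i) * volume.real (W i).1) := by
  rcases s.eq_empty_or_nonempty with rfl | hs
  -- the definition of admissibility has at least one constraint
  · simpa using h (MSet.ofSet ∅ MeasurableSet.empty)
  have e := s.equivFin.symm
  have key : ∀ F : ι → ℝ, ∑ i ∈ s, F i = ∑ i : Fin s.card, F (e i) := fun F => by
    rw [← Finset.sum_coe_sort s F, ← e.sum_comp]
  have h1 := hS s.card hs.card_pos (fun i => a (e i)) (fun i => y (e i)) (fun i => W (e i)) c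
    fun A => by simpa only [key] using h A
  rw [key]
  exact h1

/-- The covariogram of `B` observed in a translated cube, as an average of products of values of
the indicator function of `B`. -/
theorem localCov_sub_cubeWindow (x y : E d) {B : Set (E d)} (hB : MeasurableSet B) :
    localCov (x - y) (cubeWindow x).1 (MSet.ofSet B hB) =
      ∫ z in unitCube d, {z | x + z ∈ B ∧ y + z ∈ B}.indicator (fun _ => (1 : ℝ)) z := by
  have hZ : MeasurableSet {z : E d | x + z ∈ B ∧ y + z ∈ B} :=
    (measurable_const_add x hB).inter (measurable_const_add y hB)
  rw [localCov_eq, covMeasure_ofSet, integral_indicator_const _ hZ, smul_eq_mul, mul_one,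
    measureReal_restrict_apply hZ, Measure.real]
  congr 1
  rw [← measure_vadd volume x ({z : E d | x + z ∈ B ∧ y + z ∈ B} ∩ unitCube d)]
  congr 1
  ext w
  simp only [cubeWindow, Set.mem_inter_iff, Set.mem_vadd_set_iff_neg_vadd_mem, vadd_eq_add,
    Set.mem_ofPred_eq, add_neg_cancel_left]
  rw [show -(x - y) + w = y + (-x + w) by abel]

/-- The graph of the functional prescribing the covariances `S (x - y)`. -/
def covGraph (S : E d → ℝ) : Submodule ℝ (C(BinaryField d, ℝ) × ℝ) :=
  Submodule.span ℝ {(1, 1)} ⊔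
    Submodule.span ℝ (Set.range fun p : E d × E d => (BinaryField.corr p.1 p.2, S (p.1 - p.2)))

theorem mem_covGraph {S : E d → ℝ} {f : C(BinaryField d, ℝ)} {r : ℝ} (h : (f, r) ∈ covGraph S) :
    ∃ (c : ℝ) (a : E d × E d →₀ ℝ),
      f = c • (1 : C(BinaryField d, ℝ)) + ∑ p ∈ a.support, a p • BinaryField.corr p.1 p.2 ∧
      r = c + ∑ p ∈ a.support, a p * S (p.1 - p.2) := by
  obtain ⟨u, hu, v, hv, huv⟩ := Submodule.mem_sup.1 h
  obtain ⟨c, rfl⟩ := Submodule.mem_span_singleton.1 hu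
  obtain ⟨a, rfl⟩ := Finsupp.mem_span_range_iff_exists_finsupp.1 hv
  have h1 := congrArg Prod.fst huv
  have h2 := congrArg Prod.snd huv
  refine ⟨c, a, ?_, ?_⟩
  · simpa [Finsupp.sum, Prod.fst_sum] using h1.symm
  · simpa [Finsupp.sum, Prod.snd_sum] using h2.symm

/-- Evaluating at the fields `x ↦ 1_A(x + z)` and averaging over `z` in the unit cube turns a
nonnegative polynomial of degree two in the field into a nonnegative combination of local
covariograms. -/
theorem IsAdmissible.covGraph_nonneg {S : E d → ℝ} (hS : IsAdmissible S) {f : C(BinaryField d, ℝ)}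
    {r : ℝ} (h : (f, r) ∈ covGraph S) (hf : 0 ≤ f) : 0 ≤ r := by
  obtain ⟨c, a, rfl, rfl⟩ := mem_covGraph h
  have h1 := hS.nonneg a.support a (fun p => p.1 - p.2) (fun p => cubeWindow p.1) c ?_
  · have hv : ∀ x : E d, volume.real (cubeWindow x).1 = 1 := fun x => by
      simp [cubeWindow, Measure.real]
    simpa only [hv, mul_one] using h1
  · intro A
    obtain ⟨B, hB, rfl⟩ := A.exists_ofSet
    have hZ : ∀ x y : E d, MeasurableSet {z : E d | x + z ∈ B ∧ y + z ∈ B} := fun x y =>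
      (measurable_const_add x hB).inter (measurable_const_add y hB)
    have : IsProbabilityMeasure (volume.restrict (unitCube d)) := ⟨by simp⟩
    have hi : ∀ p : E d × E d, Integrable (fun z => a p *
        {z : E d | p.1 + z ∈ B ∧ p.2 + z ∈ B}.indicator (fun _ => (1 : ℝ)) z)
        (volume.restrict (unitCube d)) := fun p =>
      ((integrable_const (1 : ℝ)).indicator (hZ p.1 p.2)).const_mul _
    have hint : c + ∑ p ∈ a.support, a p *
        localCov (p.1 - p.2) (cubeWindow p.1).1 (MSet.ofSet B hB) =
        ∫ z in unitCube d, (c + ∑ p ∈ a.support, a p *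
          {z : E d | p.1 + z ∈ B ∧ p.2 + z ∈ B}.indicator (fun _ => (1 : ℝ)) z) := by
      rw [integral_add (integrable_const c) (integrable_finsetSum _ fun p _ => hi p),
        integral_finsetSum _ fun p _ => hi p]
      simp only [integral_const, probReal_univ, one_smul, integral_const_mul,
        localCov_sub_cubeWindow]
    rw [hint]
    refine integral_nonneg fun z => ?_
    have hz : 0 ≤ (c • (1 : C(BinaryField d, ℝ)) + ∑ p ∈ a.support, a p • BinaryField.corr p.1 p.2)
        (BinaryField.ofSet {x | x + z ∈ B}) := hf _
    rw [ContinuousMap.add_apply, ContinuousMap.sum_apply] at hz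
    simp only [ContinuousMap.smul_apply, ContinuousMap.one_apply, BinaryField.corr_ofSet,
      smul_eq_mul, mul_one] at hz
    exact hz

/-- An admissible function is the two-point function of a stationary binary field. -/
theorem IsAdmissible.exists_field {S : E d → ℝ} (hS : IsAdmissible S) :
    ∃ μ : Measure (BinaryField d), IsProbabilityMeasure μ ∧ (∀ t, μ.map (BinaryField.shift t) = μ) ∧
      ∀ x y, μ.real {ω | ω.eval x ∧ ω.eval y} = S (x - y) := by
  have hone : ((1 : C(BinaryField d, ℝ)), (1 : ℝ)) ∈ covGraph S :=
    Submodule.mem_sup_left (Submodule.mem_span_singleton_self _)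
  have hcorr : ∀ x y, (BinaryField.corr x y, S (x - y)) ∈ covGraph S := fun x y =>
    Submodule.mem_sup_right (Submodule.subset_span ⟨(x, y), rfl⟩)
  obtain ⟨L, hLpos, hLΓ, hLT⟩ := exists_invariant_positive_extension (V := C(BinaryField d, ℝ))
    (e := 1) (T := BinaryField.shiftOp) (Γ := covGraph S)
    (fun v => ⟨‖v‖, fun ω => by
      have := (le_abs_self _).trans (v.norm_coe_le_norm ω)
      simpa using this⟩)
    (fun s t => by
      refine LinearMap.ext fun f => ContinuousMap.ext fun ω => ?_
      simp only [Module.End.mul_apply, BinaryField.shiftOp_apply]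
      rw [BinaryField.shift_shift])
    (fun t v hv ω => hv (BinaryField.shift t ω)) (fun t => rfl) hone
    (fun f r h hf => hS.covGraph_nonneg h hf)
    (fun t f r h => by
      have hle : covGraph S ≤
          (covGraph S).comap ((BinaryField.shiftOp t).prodMap LinearMap.id) := by
        refine sup_le ?_ ?_
        · rw [Submodule.span_le, Set.singleton_subset_iff]
          exact hone
        · rw [Submodule.span_le]
          rintro _ ⟨p, rfl⟩
          change (BinaryField.shiftOp t (BinaryField.corr p.1 p.2), S (p.1 - p.2)) ∈ covGraph S
          rw [BinaryField.shiftOp_corr, ← sub_sub_sub_cancel_right p.1 p.2 t]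
          exact hcorr _ _
      exact hle h)
  obtain ⟨μ, hμ, hμr, hμL⟩ := exists_probability_of_positive L hLpos (hLΓ _ _ hone)
  refine ⟨μ, hμ, fun t => map_eq_of_integral_eq _ fun f => ?_, fun x y => ?_⟩
  · rw [hμL f, ← hLT t f, ← hμL]
    rfl
  · have h := hμL (BinaryField.corr x y)
    rw [hLΓ _ _ (hcorr x y)] at h
    rw [← h]
    have hm : MeasurableSet {ω : BinaryField d | ω.eval x ∧ ω.eval y} :=
      ((BinaryField.continuous_eval x).measurable (measurableSet_singleton true)).inter
        ((BinaryField.continuous_eval y).measurable (measurableSet_singleton true))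
    rw [← integral_indicator_one hm]
    refine integral_congr_ae (Eventually.of_forall fun ω => ?_)
    simp [BinaryField.corr_apply, Set.indicator_apply]

end BinaryField

/-! ### From binary fields to random measurable sets -/

section DyadicFloor

variable {d : ℕ}

/-- The point of the lattice `2⁻ⁿ ℤ^d` with index `k`. -/
def dyadicPoint (n : ℕ) (k : Fin d → ℤ) : E d := WithLp.toLp 2 fun j => (k j : ℝ) / 2 ^ n

/-- The index of the dyadic cube of side `2⁻ⁿ` containing `x`. -/
def dyadicIndex (n : ℕ) (x : E d) (j : Fin d) : ℤ := ⌊(2 : ℝ) ^ n * x j⌋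

/-- The corner of the dyadic cube of side `2⁻ⁿ` containing `x`. -/
def dyadicFloor (n : ℕ) (x : E d) : E d := dyadicPoint n (dyadicIndex n x)

theorem abs_dyadicFloor_sub_le (n : ℕ) (x : E d) (j : Fin d) :
    |dyadicFloor n x j - x j| ≤ (1 / 2) ^ n := by
  have h2 : (0 : ℝ) < 2 ^ n := by positivity
  have h : dyadicFloor n x j - x j = -(Int.fract ((2 : ℝ) ^ n * x j)) / 2 ^ n := by
    rw [Int.fract]
    simp only [dyadicFloor, dyadicPoint, dyadicIndex]
    field_simp
    ring
  rw [h, abs_div, abs_neg, abs_of_pos h2, abs_of_nonneg (Int.fract_nonneg _), one_div_pow]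
  gcongr
  exact (Int.fract_lt_one _).le

theorem measurable_dyadicIndex (n : ℕ) : Measurable (dyadicIndex (d := d) n) :=
  measurable_pi_lambda _ fun j => Int.measurable_floor.comp
    (measurable_const.mul (by fun_prop))

end DyadicFloor

section Modification

variable {d : ℕ}

theorem BinaryField.measurableSet_eval (x : E d) :
    MeasurableSet {ω : BinaryField d | ω.eval x = true} :=
  (BinaryField.continuous_eval x).measurable (measurableSet_singleton true)

/-- A jointly measurable version of the set `{x | ω(x) = 1}`: the upper limit of the discretizations
of the field `ω` along dyadic cubes. -/
def fieldSet (d : ℕ) : Set (BinaryField d × E d) :=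
  {p | ∃ᶠ n in atTop, p.1.eval (dyadicFloor n p.2) = true}

theorem measurableSet_fieldSet : MeasurableSet (fieldSet d) := by
  have h : ∀ n : ℕ,
      MeasurableSet {p : BinaryField d × E d | p.1.eval (dyadicFloor n p.2) = true} := by
    intro n
    have : {p : BinaryField d × E d | p.1.eval (dyadicFloor n p.2) = true} =
        ⋃ k : Fin d → ℤ, {ω : BinaryField d | ω.eval (dyadicPoint n k) = true} ×ˢ
          (dyadicIndex n ⁻¹' {k}) := by
      ext ⟨ω, x⟩
      simp [dyadicFloor]
    rw [this]
    exact MeasurableSet.iUnion fun k => (BinaryField.measurableSet_eval _).prod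
      (measurable_dyadicIndex n (measurableSet_singleton k))
  have hl : fieldSet d =
      limsup (fun n => {p : BinaryField d × E d | p.1.eval (dyadicFloor n p.2) = true}) atTop := by
    ext p
    rw [mem_limsup_iff_frequently_mem]
    rfl
  rw [hl]
  exact MeasurableSet.measurableSet_limsup h

/-- The random measurable set associated with a binary field. -/
def fieldRAMS (ω : BinaryField d) : MSet d :=
  MSet.ofSet {x | (ω, x) ∈ fieldSet d} (measurable_prodMk_left measurableSet_fieldSet)

theorem measurable_fieldRAMS : Measurable (fieldRAMS (d := d)) := by
  refine MSet.measurable_of_locDist fun U hU B => ?_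
  obtain ⟨B, hB, rfl⟩ := B.exists_ofSet
  have hm : MeasurableSet ((fieldSet d ∆ (Prod.snd ⁻¹' B)) ∩ Prod.snd ⁻¹' U) :=
    (measurableSet_fieldSet.symmDiff (measurable_snd hB)).inter (measurable_snd hU.measurableSet)
  exact measurable_measure_prodMk_left hm

theorem measure_eval_ne_triangle (μ : Measure (BinaryField d)) (x y z : E d) :
    μ {ω | ω.eval x ≠ ω.eval z} ≤ μ {ω | ω.eval x ≠ ω.eval y} + μ {ω | ω.eval y ≠ ω.eval z} := by
  refine (measure_mono fun ω hω => ?_).trans (measure_union_le _ _)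
  by_cases h : ω.eval x = ω.eval y
  · exact Or.inr fun h' => hω (h.trans h')
  · exact Or.inl h

variable {μ : Measure (BinaryField d)} [IsProbabilityMeasure μ] {S : E d → ℝ}

/-- The increments of a field with two-point function `S (x - y)`. -/
theorem measureReal_eval_ne (hμ : ∀ x y, μ.real {ω | ω.eval x ∧ ω.eval y} = S (x - y))
    (x y : E d) : μ.real {ω | ω.eval x ≠ ω.eval y} = 2 * (S 0 - S (x - y)) := by
  have hx := BinaryField.measurableSet_eval x
  have hy := BinaryField.measurableSet_eval y
  have h1 : ∀ z : E d, μ.real {ω : BinaryField d | ω.eval z = true} = S 0 := fun z => by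
    simpa using hμ z z
  have h2 : {ω : BinaryField d | ω.eval x ≠ ω.eval y} =
      ({ω | ω.eval x = true} \ {ω | ω.eval y = true}) ∪
        ({ω | ω.eval y = true} \ {ω | ω.eval x = true}) := by
    ext ω
    change ω.eval x ≠ ω.eval y ↔
      (ω.eval x = true ∧ ¬ω.eval y = true) ∨ (ω.eval y = true ∧ ¬ω.eval x = true)
    cases ω.eval x <;> cases ω.eval y <;> simp
  have h3 := measureReal_sdiff_add_inter (μ := μ) (s := {ω | ω.eval x = true}) hy
  have h4 := measureReal_sdiff_add_inter (μ := μ) (s := {ω | ω.eval y = true}) hx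
  rw [Set.inter_comm] at h4
  have h5 : μ.real ({ω | ω.eval x = true} ∩ {ω | ω.eval y = true}) = S (x - y) := hμ x y
  rw [h1, h5] at h3 h4
  rw [h2, measureReal_union _ (hy.diff hx)]
  · linarith
  · exact disjoint_sdiff_sdiff

theorem measure_eval_add_smul_ne_le
    (hμ : ∀ x y, μ.real {ω | ω.eval x ∧ ω.eval y} = S (x - y)) (j : Fin d) (x : E d) (t : ℝ) :
    μ {ω | ω.eval (x + t • basisVec j) ≠ ω.eval x} ≤
      2 * lipAt j S 0 * ENNReal.ofReal |t| := by
  rcases eq_or_ne t 0 with rfl | ht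
  · simp
  have ht' : 0 < |t| := abs_pos.2 ht
  have h1 : ENNReal.ofReal (|S (0 + t • basisVec j) - S 0| / |t|) ≤ lipAt j S 0 :=
    le_iSup_of_le t (le_iSup_of_le ht le_rfl)
  calc μ {ω | ω.eval (x + t • basisVec j) ≠ ω.eval x}
      = ENNReal.ofReal (2 * (S 0 - S (t • basisVec j))) := by
        rw [← ofReal_measureReal (measure_ne_top μ _), measureReal_eval_ne hμ, add_sub_cancel_left]
    _ ≤ ENNReal.ofReal (2 * (|S (0 + t • basisVec j) - S 0| / |t|) * |t|) := by
        apply ENNReal.ofReal_le_ofReal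
        rw [mul_assoc, div_mul_cancel₀ _ ht'.ne', zero_add, abs_sub_comm]
        gcongr
        exact le_abs_self _
    _ = 2 * ENNReal.ofReal (|S (0 + t • basisVec j) - S 0| / |t|) * ENNReal.ofReal |t| := by
        rw [ENNReal.ofReal_mul (by positivity), ENNReal.ofReal_mul zero_le_two,
          ENNReal.ofReal_ofNat]
    _ ≤ 2 * lipAt j S 0 * ENNReal.ofReal |t| := by gcongr

/-- Lipschitz continuity in probability, obtained by moving along one coordinate after the other. -/
theorem measure_eval_ne_le (hμ : ∀ x y, μ.real {ω | ω.eval x ∧ ω.eval y} = S (x - y))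
    (x y : E d) :
    μ {ω | ω.eval x ≠ ω.eval y} ≤
      ∑ j, 2 * lipAt j S 0 * ENNReal.ofReal |x j - y j| := by
  have key : ∀ s : Finset (Fin d),
      μ {ω | ω.eval (y + ∑ j ∈ s, (x j - y j) • basisVec j) ≠ ω.eval y} ≤
        ∑ j ∈ s, 2 * lipAt j S 0 * ENNReal.ofReal |x j - y j| := by
    intro s
    induction s using Finset.induction_on with
    | empty => simp
    | insert j s hj ih =>
      rw [Finset.sum_insert hj, Finset.sum_insert hj, add_comm ((x j - y j) • basisVec j),
        ← add_assoc]
      exact (measure_eval_ne_triangle _ _ _ _).trans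
        (add_le_add (measure_eval_add_smul_ne_le hμ j _ _) ih)
  have hx : y + ∑ j, (x j - y j) • basisVec j = x := by
    ext i
    simp [basisVec, Finset.sum_apply, Pi.single_apply]
  have h := key Finset.univ
  rwa [hx] at h

/-- The discretizations converge almost surely at each point, by the Borel–Cantelli lemma. -/
theorem ae_mem_fieldSet_iff (hμ : ∀ x y, μ.real {ω | ω.eval x ∧ ω.eval y} = S (x - y))
    (hS : ∀ j, lipAt j S 0 < ⊤) (x : E d) :
    ∀ᵐ ω ∂μ, ((ω, x) ∈ fieldSet d ↔ ω.eval x = true) := by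
  have hC : ∑ j, 2 * lipAt j S 0 ≠ ⊤ :=
    ENNReal.sum_ne_top.2 fun j _ => ENNReal.mul_ne_top (by simp) (hS j).ne
  have hle : ∀ n : ℕ, μ {ω | ω.eval (dyadicFloor n x) ≠ ω.eval x} ≤
      (∑ j, 2 * lipAt j S 0) * ENNReal.ofReal ((1 / 2) ^ n) := by
    intro n
    refine (measure_eval_ne_le hμ _ _).trans ?_
    rw [Finset.sum_mul]
    refine Finset.sum_le_sum fun j _ => ?_
    gcongr
    exact abs_dyadicFloor_sub_le n x j
  have hsum : ∑' n : ℕ, μ {ω | ω.eval (dyadicFloor n x) ≠ ω.eval x} ≠ ⊤ := by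
    refine ne_top_of_le_ne_top ?_ (ENNReal.tsum_le_tsum hle)
    rw [ENNReal.tsum_mul_left]
    exact ENNReal.mul_ne_top hC
      (Summable.tsum_ofReal_ne_top (summable_geometric_of_lt_one (by norm_num) (by norm_num)))
  filter_upwards [ae_eventually_notMem hsum] with ω hω
  have hω' : ∀ᶠ n in atTop, (ω.eval (dyadicFloor n x) = true ↔ ω.eval x = true) :=
    hω.mono fun n hn => by
      rw [show ω.eval (dyadicFloor n x) = ω.eval x from not_not.1 hn]
  change (∃ᶠ n in atTop, ω.eval (dyadicFloor n x) = true) ↔ _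
  rw [frequently_congr hω']
  simp

/-- Fubini's theorem: the mean of `𝓛^d(X ∩ (y + X) ∩ (0,1)^d)` is the integral over `x ∈ (0,1)^d` of
the probability that both `x` and `x - y` belong to `X`. -/
theorem specificCov_fieldRAMS (hμ : ∀ x y, μ.real {ω | ω.eval x ∧ ω.eval y} = S (x - y))
    (hS : ∀ j, lipAt j S 0 < ⊤) (y : E d) : specificCov μ (fieldRAMS (d := d)) y = S y := by
  have hSy : 0 ≤ S y := by
    have h := hμ y 0
    rw [sub_zero] at h
    rw [← h]
    exact measureReal_nonneg
  set T : Set (BinaryField d × E d) := {p | (p ∈ fieldSet d ∧ (p.1, p.2 - y) ∈ fieldSet d) ∧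
    p.2 ∈ unitCube d} with hT
  have hTm : MeasurableSet T := by
    refine (measurableSet_fieldSet.inter ?_).inter
      (measurable_snd isOpen_unitCube.measurableSet)
    exact (measurable_fst.prodMk (measurable_snd.sub_const y)) measurableSet_fieldSet
  have h1 : ∀ ω : BinaryField d, covMeasure y (unitCube d) (fieldRAMS ω) =
      volume (Prod.mk ω ⁻¹' T) := by
    intro ω
    rw [fieldRAMS, covMeasure_ofSet]
    congr 1
    ext x
    simp only [hT, Set.mem_inter_iff, Set.mem_vadd_set_iff_neg_vadd_mem, vadd_eq_add,
      Set.mem_ofPred_eq, Set.mem_preimage, sub_eq_neg_add]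
  have h2 : ∀ x : E d, μ ((fun ω => (ω, x)) ⁻¹' T) =
      (unitCube d).indicator (fun _ => ENNReal.ofReal (S y)) x := by
    intro x
    by_cases hx : x ∈ unitCube d
    · rw [Set.indicator_of_mem hx]
      have h3 := hμ x (x - y)
      rw [sub_sub_cancel] at h3
      rw [← h3, ofReal_measureReal]
      refine measure_congr ?_
      filter_upwards [ae_mem_fieldSet_iff hμ hS x, ae_mem_fieldSet_iff hμ hS (x - y)] with ω e1 e2
      refine propext ?_
      change ((((ω, x) ∈ fieldSet d) ∧ ((ω, x - y) ∈ fieldSet d)) ∧ x ∈ unitCube d) ↔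
        (ω.eval x = true ∧ ω.eval (x - y) = true)
      rw [e1, e2]
      exact and_iff_left hx
    · rw [Set.indicator_of_notMem hx]
      have : (fun ω => (ω, x)) ⁻¹' T = ∅ := by
        ext ω
        simp [hT, hx]
      rw [this, measure_empty]
  rw [specificCov_eq measurable_fieldRAMS]
  simp only [h1]
  rw [← Measure.prod_apply hTm, Measure.prod_apply_symm hTm]
  simp only [h2]
  rw [lintegral_indicator isOpen_unitCube.measurableSet]
  simp [hSy]

/-- The discretization does not commute with translations, but its limit almost surely does. -/
theorem fieldRAMS_shift (hμ : ∀ x y, μ.real {ω | ω.eval x ∧ ω.eval y} = S (x - y))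
    (hS : ∀ j, lipAt j S 0 < ⊤) (hinv : ∀ t, μ.map (BinaryField.shift t) = μ) (t : E d) :
    (fun ω => (fieldRAMS ω).translate t) =ᵐ[μ] fun ω => fieldRAMS (BinaryField.shift t ω) := by
  have hsm : Measurable (BinaryField.shift t : BinaryField d → BinaryField d) :=
    (BinaryField.shift t).continuous.measurable
  have hx : ∀ᵐ x ∂(volume : Measure (E d)), ∀ᵐ ω ∂μ,
      ((ω, x - t) ∈ fieldSet d ↔ (BinaryField.shift t ω, x) ∈ fieldSet d) := by
    refine Eventually.of_forall fun x => ?_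
    have h1 := ae_mem_fieldSet_iff hμ hS x
    rw [← hinv t] at h1
    filter_upwards [ae_of_ae_map hsm.aemeasurable h1, ae_mem_fieldSet_iff hμ hS (x - t)] with
      ω e1 e2
    rw [e1, e2, BinaryField.eval_shift]
  have hm : MeasurableSet {p : E d × BinaryField d |
      ((p.2, p.1 - t) ∈ fieldSet d ↔ (BinaryField.shift t p.2, p.1) ∈ fieldSet d)} := by
    have m1 : MeasurableSet {p : E d × BinaryField d | (p.2, p.1 - t) ∈ fieldSet d} :=
      (measurable_snd.prodMk (measurable_fst.sub_const t)) measurableSet_fieldSet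
    have m2 :
        MeasurableSet {p : E d × BinaryField d | (BinaryField.shift t p.2, p.1) ∈ fieldSet d} :=
      ((hsm.comp measurable_snd).prodMk measurable_fst) measurableSet_fieldSet
    exact m1.iff m2
  filter_upwards [(Measure.ae_ae_comm hm).1 hx] with ω hω
  rw [fieldRAMS, MSet.translate_ofSet, fieldRAMS, MSet.ofSet_eq_iff]
  filter_upwards [hω] with x hx
  refine propext ?_
  change x ∈ t +ᵥ {x | (ω, x) ∈ fieldSet d} ↔ (BinaryField.shift t ω, x) ∈ fieldSet d
  rw [Set.mem_vadd_set_iff_neg_vadd_mem, vadd_eq_add, ← sub_eq_neg_add]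
  exact hx

theorem isStationaryRAMS_fieldRAMS
    (hμ : ∀ x y, μ.real {ω | ω.eval x ∧ ω.eval y} = S (x - y))
    (hS : ∀ j, lipAt j S 0 < ⊤) (hinv : ∀ t, μ.map (BinaryField.shift t) = μ) :
    IsStationaryRAMS μ (fieldRAMS (d := d)) where
  measurable := measurable_fieldRAMS
  stationary t := by
    rw [Measure.map_congr (fieldRAMS_shift hμ hS hinv t)]
    have h := Measure.map_map (μ := μ) measurable_fieldRAMS
      (BinaryField.shift t).continuous.measurable
    rw [hinv t] at h
    exact h.symm

end Modification

/-- A stationary random measurable set can be carried to any universe. -/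
theorem IsStationaryRAMS.ulift {d : ℕ} {Ω : Type} [MeasurableSpace Ω] {P : Measure Ω}
    {X : Ω → MSet d} (hX : IsStationaryRAMS P X) :
    IsStationaryRAMS (P.map (ULift.up.{u})) (fun ω => X ω.down) where
  measurable := hX.measurable.comp measurable_down
  stationary t := by
    have hm : Measurable fun ω : ULift.{u} Ω => X ω.down := hX.measurable.comp measurable_down
    have hm' : Measurable fun ω : ULift.{u} Ω => (X ω.down).translate t :=
      (MSet.continuous_translate t).measurable.comp hm
    rw [Measure.map_map hm' measurable_up, Measure.map_map hm measurable_up]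
    exact hX.stationary t

/-- Realizability by a stationary random measurable set. -/
theorem IsAdmissible.exists_isStationaryRAMS {d : ℕ} {S : E d → ℝ} (hS : IsAdmissible S)
    (hlip : ∀ j, lipAt j S 0 < ⊤) :
    ∃ (Ω : Type u) (_ : MeasurableSpace Ω) (P : Measure Ω) (_ : IsProbabilityMeasure P)
      (X : Ω → MSet d), IsStationaryRAMS P X ∧ specificCov P X = S := by
  obtain ⟨μ, _, hinv, hμ⟩ := hS.exists_field
  refine ⟨ULift.{u} (BinaryField d), inferInstance, μ.map ULift.up,
    Measure.isProbabilityMeasure_map measurable_up.aemeasurable, fun ω => fieldRAMS ω.down,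
    (isStationaryRAMS_fieldRAMS hμ hlip hinv).ulift, funext fun y => ?_⟩
  rw [← specificCov_fieldRAMS hμ hlip y]
  exact integral_map_equiv (MeasurableEquiv.ulift.{0, u} (α := BinaryField d)).symm _

end RandomSets

end

theorem mainTheorem1 (d : ℕ) (S₂ : RandomSets.E d → ℝ) :
    (∀ r : ℝ, 0 ≤ r →
      ((∃ (Ω : Type u) (_ : MeasurableSpace Ω) (P : MeasureTheory.Measure Ω)
          (_ : MeasureTheory.IsProbabilityMeasure P) (X : Ω → RandomSets.MSet d),
          RandomSets.IsStationaryRAMS P X ∧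
          (∀ y, S₂ y = RandomSets.specificCov P X y) ∧
          RandomSets.specificAnisoPer P X ≤ ENNReal.ofReal r) ↔
        (RandomSets.IsAdmissible S₂ ∧
          ∑ j : Fin d, RandomSets.lipAt j S₂ 0 ≤ ENNReal.ofReal (r / 2)))) ∧
    ((∃ (Ω : Type u) (_ : MeasurableSpace Ω) (P : MeasureTheory.Measure Ω)
        (_ : MeasureTheory.IsProbabilityMeasure P) (X : Ω → RandomSets.MSet d),
        RandomSets.IsStationaryRAMS P X ∧
        (∀ y, S₂ y = RandomSets.specificCov P X y) ∧
        RandomSets.specificPer P X < ⊤) ↔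
      (RandomSets.IsAdmissible S₂ ∧ ∀ j : Fin d, RandomSets.lipAt j S₂ 0 < ⊤)) := by
  open RandomSets in
  constructor
  · intro r _
    have hr : ENNReal.ofReal r = 2 * ENNReal.ofReal (r / 2) := by
      rw [← ENNReal.ofReal_ofNat 2, ← ENNReal.ofReal_mul zero_le_two, mul_div_cancel₀ r two_ne_zero]
    rw [hr]
    constructor
    · rintro ⟨Ω, _, P, _, X, hX, hS, hper⟩
      obtain rfl : S₂ = specificCov P X := funext hS
      exact ⟨hX.isAdmissible, (ENNReal.mul_le_mul_iff_right two_ne_zero (by simp)).1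
        (hX.two_mul_sum_lipAt_le.trans hper)⟩
    · rintro ⟨hS, hlip⟩
      obtain ⟨Ω, _, P, _, X, hX, rfl⟩ := hS.exists_isStationaryRAMS.{u} fun j =>
        ((Finset.single_le_sum (fun _ _ => zero_le) (Finset.mem_univ j)).trans hlip).trans_lt
          ENNReal.ofReal_lt_top
      refine ⟨Ω, _, P, ‹_›, X, hX, fun _ => rfl, hX.specificAnisoPer_le.trans ?_⟩
      gcongr
  · constructor
    · rintro ⟨Ω, _, P, _, X, hX, hS, hper⟩
      obtain rfl : S₂ = specificCov P X := funext hS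
      refine ⟨hX.isAdmissible, fun j => ?_⟩
      have h := (hX.two_mul_lipAt_le_specificPer j).trans_lt hper
      exact (le_mul_of_one_le_left' one_le_two).trans_lt h
    · rintro ⟨hS, hlip⟩
      obtain ⟨Ω, _, P, _, X, hX, rfl⟩ := hS.exists_isStationaryRAMS.{u} hlip
      refine ⟨Ω, _, P, ‹_›, X, hX, fun _ => rfl, ?_⟩
      refine ((specificPer_le_specificAnisoPer P X).trans hX.specificAnisoPer_le).trans_lt ?_
      exact ENNReal.mul_lt_top (by simp) (ENNReal.sum_lt_top.2 fun j _ => hlip j)
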